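/- Let $n=2m$ with $m\ge 1$ an integer. Let $W=\mathbb{C}^{2n}$ with standard basis $e_1,\dots,e_{2n}$, let $b(z,w)=\sum_{i=1}^n(z_iw_{n+i}+z_{n+i}w_i)$, and let $W_1=\operatorname{span}_{\mathbb C}(e_1,\dots,e_n)$. The Clifford algebra $C(W,b)$ of the quadratic form $\tfrac12 b(z,z)=\sum_{i=1}^n z_iz_{n+i}$ acts on $\bigwedge^\bullet W_1$: $e_i$ ($i\le n$) acts by exterior product with $e_i$, and $e_{n+i}$ acts by interior product with the $i$-th coordinate functional of $W_1$. The half spin representations of $\mathrm{Spin}(W,b)\subset C(W,b)^{\times}$ are the resulting representations on $S^+=\bigwedge^{\mathrm{even}}W_1$ and $S^-=\bigwedge^{\mathrm{odd}}W_1$. For a subgroup $H$ of $\mathrm{SO}(W,b)$, the spin double cover of $H$ means the neutral (identity) component of the inverse image of $H$ in $\mathrm{Spin}(W,b)$; it acts on $S^\pm$ and, through $H$, on the standard representation $W$. A complex representation $V$ of a group $G$ can be defined over $\mathbb{R}$ if $V\cong \mathbb{C}\otimes_{\mathbb R}V_0$ for some real representation $V_0$ of $G$. (i) Let $\mathrm{SO}^*(4m)=\mathrm{SO}^*(2n)$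 be the group of $g\in\mathrm{SL}(W)$ preserving both $b$ and the Hermitian form $\psi_0(z,w)=\sum_{i=1}^n z_i\bar w_i-\sum_{i=1}^n z_{n+i}\bar w_{n+i}$. As representations of the spin double cover of $\mathrm{SO}^*(4m)$, $S^+$ can be defined over $\mathbb{R}$ and $S^-$ cannot be defined over $\mathbb{R}$. (ii) Let $0\le k\le n$. Let $V_{\mathbb R}\subset W$ be the real span of the vectors $\sqrt{-1}(e_i+e_{n+i})$ and $e_i-e_{n+i}$ for $1\le i\le k$, and $e_i+e_{n+i}$ and $\sqrt{-1}(e_i-e_{n+i})$ for $k<i\le n$; then $b|_{V_{\mathbb R}}$ is real of signature $(2n-2k,2k)$, and $\mathrm{SO}(2n-2k,2k)=\mathrm{SO}(V_{\mathbb R},b)$ is viewed as a subgroup of $\mathrm{SO}(W,b)$ by complex-linear extension. For the spin double cover of $\mathrm{SO}(2n-2k,2k)$: if $k\equiv m \pmod 2$, then $S^+$, $S^-$ and the standard representation $W$ can all be defined over $\mathbb{R}$; if $k\not\equiv m\pmod 2$, then neither $S^+$ nor $S^-$ can be defined over $\mathbb{R}$. -/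

import Mathlib

open CliffordAlgebra
open scoped TensorProduct

noncomputable section

namespace HalfSpin

/-! ### The quadratic space `(W, b)` and its spin group -/

/-- `W = ℂ^{2n}`, in coordinates: `z (inl i)` is `z_i` and `z (inr i)` is `z_{n+i}`. -/
abbrev W (n : ℕ) : Type := Fin n ⊕ Fin n → ℂ

/-- The standard basis vector of `W`: `e (inl i)` is `e_i` and `e (inr i)` is `e_{n+i}`. -/
def e (n : ℕ) (r : Fin n ⊕ Fin n) : W n := Pi.single r 1

/-- The bilinear form `b(z, w) = ∑ i, (z_i w_{n+i} + z_{n+i} w_i)`. -/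
def b (n : ℕ) (z w : W n) : ℂ :=
  ∑ i : Fin n, (z (Sum.inl i) * w (Sum.inr i) + z (Sum.inr i) * w (Sum.inl i))

/-- The Hermitian form `ψ₀(z, w) = ∑ i, z_i conj(w_i) - ∑ i, z_{n+i} conj(w_{n+i})`. -/
def psi0 (n : ℕ) (z w : W n) : ℂ :=
  ∑ i : Fin n, z (Sum.inl i) * starRingEnd ℂ (w (Sum.inl i))
    - ∑ i : Fin n, z (Sum.inr i) * starRingEnd ℂ (w (Sum.inr i))

/-- The quadratic form `Q(z) = b(z, z) / 2 = ∑ i, z_i z_{n+i}`. In its Clifford algebra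
`e_i e_{n+i} + e_{n+i} e_i = 1`. -/
def Q (n : ℕ) : QuadraticForm ℂ (W n) :=
  ∑ i : Fin n, QuadraticMap.proj (Sum.inl i) (Sum.inr i)

theorem Q_apply (n : ℕ) (z : W n) : Q n z = ∑ i : Fin n, z (Sum.inl i) * z (Sum.inr i) := by
  simp [Q]

theorem polar_Q (n : ℕ) (z w : W n) : QuadraticMap.polar (Q n) z w = b n z w := by
  simp only [QuadraticMap.polar, Q_apply, b, Pi.add_apply, ← Finset.sum_sub_distrib]
  exact Finset.sum_congr rfl fun i _ => by ring

/-- The Clifford algebra `C(W, b)`, with the canonical topology of a (finite-dimensional) complex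
vector space. -/
abbrev Cl (n : ℕ) : Type := CliffordAlgebra (Q n)

instance clTopology (n : ℕ) : TopologicalSpace (Cl n) := moduleTopology ℂ (Cl n)

instance clIsModuleTopology (n : ℕ) : IsModuleTopology ℂ (Cl n) := ⟨rfl⟩

/-- The complex spin group `Spin(W, b)`. -/
abbrev Spin (n : ℕ) : Type := spinGroup (Q n)

theorem iota_injective (n : ℕ) : Function.Injective (ι (Q n)) := by
  intro x y h
  have h2 := congrArg (equivExterior (Q n)) h
  simp only [equivExterior, changeFormEquiv_apply, changeForm_ι] at h2
  exact ExteriorAlgebra.ι_inj ℂ _ _ |>.1 h2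

theorem spin_conj_mem {n : ℕ} (x : Spin n) (w : W n) :
    (x : Cl n) * ι (Q n) w * star (x : Cl n) ∈ LinearMap.range (ι (Q n)) := by
  have h := spinGroup.conjAct_smul_ι_mem_range_ι (Q := Q n) (x := spinGroup.toUnits x)
    (by simp) w
  have hinv : ((spinGroup.toUnits x)⁻¹ : (Cl n)ˣ) = spinGroup.toUnits (star x) := by
    rw [← map_inv, spinGroup.star_eq_inv]
  rw [ConjAct.units_smul_def, ConjAct.ofConjAct_toConjAct, hinv] at h
  exact h

/-- The covering homomorphism on elements: `rho x w` is the vector `x w x⁻¹`, where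
`x⁻¹ = star x` in the spin group. -/
def rhoLin {n : ℕ} (x : Spin n) : W n →ₗ[ℂ] W n :=
  (LinearEquiv.ofInjective (ι (Q n)) (iota_injective n)).symm.toLinearMap ∘ₗ
    LinearMap.codRestrict (LinearMap.range (ι (Q n)))
      (LinearMap.mulRight ℂ (star (x : Cl n)) ∘ₗ LinearMap.mulLeft ℂ (x : Cl n) ∘ₗ ι (Q n))
      (fun w => spin_conj_mem x w)

theorem iota_rhoLin {n : ℕ} (x : Spin n) (w : W n) :
    ι (Q n) (rhoLin x w) = (x : Cl n) * ι (Q n) w * star (x : Cl n) := by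
  have h := LinearEquiv.apply_symm_apply (LinearEquiv.ofInjective (ι (Q n)) (iota_injective n))
    ⟨(x : Cl n) * ι (Q n) w * star (x : Cl n), spin_conj_mem x w⟩
  exact congrArg Subtype.val h

/-- The standard representation of `Spin(W, b)` on `W`. -/
def rho (n : ℕ) : Representation ℂ (Spin n) (W n) where
  toFun := rhoLin
  map_one' := by
    ext1 w
    apply LinearMap.ext
    intro w
    apply iota_injective n
    simp [iota_rhoLin]
  map_mul' x y := by
    apply LinearMap.ext
    intro w
    apply iota_injective n
    simp [iota_rhoLin, mul_assoc]

/-- The inverse image in `Spin(W, b)` of a group of linear automorphisms of `W`. -/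
def preimage {n : ℕ} (H : Subgroup (LinearMap.GeneralLinearGroup ℂ (W n))) :
    Subgroup (Spin n) :=
  H.comap (rho n).toHomUnits

/-- The inverse image of `H`, as a subset of the Clifford algebra. -/
def preimageSet {n : ℕ} (H : Subgroup (LinearMap.GeneralLinearGroup ℂ (W n))) : Set (Cl n) :=
  (fun x : Spin n => (x : Cl n)) '' (preimage H : Set (Spin n))

theorem mul_mem_component {n : ℕ} (H : Subgroup (LinearMap.GeneralLinearGroup ℂ (W n)))
    {x : Spin n} (hx : x ∈ preimage H) {a : Cl n} {c : Cl n}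
    (ha : a ∈ connectedComponentIn (preimageSet H) 1)
    (hc : c ∈ connectedComponentIn (preimageSet H) 1)
    (hxa : (x : Cl n) * a ∈ connectedComponentIn (preimageSet H) 1) :
    (x : Cl n) * c ∈ connectedComponentIn (preimageSet H) 1 := by
  have : ContinuousAdd (Cl n) := IsModuleTopology.toContinuousAdd ℂ (Cl n)
  have hcont : Continuous (LinearMap.mulLeft ℂ (x : Cl n)) :=
    IsModuleTopology.continuous_of_linearMap _
  have hpre : IsPreconnected
      ((LinearMap.mulLeft ℂ (x : Cl n)) '' connectedComponentIn (preimageSet H) 1) :=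
    isPreconnected_connectedComponentIn.image _ hcont.continuousOn
  have hsub : (LinearMap.mulLeft ℂ (x : Cl n)) '' connectedComponentIn (preimageSet H) 1
      ⊆ preimageSet H := by
    rintro _ ⟨d, hd, rfl⟩
    obtain ⟨y, hy, rfl⟩ := connectedComponentIn_subset _ _ hd
    exact ⟨x * y, mul_mem hx hy, rfl⟩
  have h := hpre.subset_connectedComponentIn (Set.mem_image_of_mem _ ha) hsub
  have heq := connectedComponentIn_eq hxa
  rw [heq]
  exact h (Set.mem_image_of_mem _ hc)

/-- The spin double cover of a group `H` of linear automorphisms of `W` preserving `b`: the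
neutral component of the inverse image of `H` in `Spin(W, b)`. -/
def spinCover {n : ℕ} (H : Subgroup (LinearMap.GeneralLinearGroup ℂ (W n))) :
    Subgroup (Spin n) where
  carrier := {x | (x : Cl n) ∈ connectedComponentIn (preimageSet H) 1}
  one_mem' := mem_connectedComponentIn ⟨1, one_mem _, rfl⟩
  mul_mem' := by
    intro x y hx hy
    have h1 : (1 : Cl n) ∈ connectedComponentIn (preimageSet H) 1 :=
      mem_connectedComponentIn ⟨1, one_mem _, rfl⟩
    obtain ⟨x', hx', hxx⟩ := connectedComponentIn_subset _ _ hx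
    obtain rfl : x' = x := Subtype.ext hxx
    exact mul_mem_component H hx' h1 hy (by simpa using hx)
  inv_mem' := by
    intro x hx
    have h1 : (1 : Cl n) ∈ connectedComponentIn (preimageSet H) 1 :=
      mem_connectedComponentIn ⟨1, one_mem _, rfl⟩
    obtain ⟨x', hx', hxx⟩ := connectedComponentIn_subset _ _ hx
    obtain rfl : x' = x := Subtype.ext hxx
    have h := mul_mem_component H (inv_mem hx') hx h1 (by
      have : ((x'⁻¹ : Spin n) : Cl n) * (x' : Cl n) = 1 := by
        rw [← Submonoid.coe_mul, inv_mul_cancel, Submonoid.coe_one]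
      rw [this]; exact h1)
    simpa using h

/-! ### The half spin representations -/

/-- The isotropic subspace `W₁` spanned by `e_1, …, e_n`, in coordinates. -/
abbrev W1 (n : ℕ) : Type := Fin n → ℂ

/-- The component of a vector of `W` in `W₁`. -/
def toW1 (n : ℕ) : W n →ₗ[ℂ] W1 n := LinearMap.funLeft ℂ ℂ Sum.inl

/-- The component of a vector of `W` in `W₂ = span(e_{n+1}, …, e_{2n})`, as a linear functional on
`W₁`: the vector `e_{n+i}` is sent to the `i`-th coordinate function. -/
def toDual (n : ℕ) : W n →ₗ[ℂ] Module.Dual ℂ (W1 n) :=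
  ∑ i : Fin n, (LinearMap.proj (Sum.inr i) : W n →ₗ[ℂ] ℂ).smulRight
    (LinearMap.proj i : Module.Dual ℂ (W1 n))

theorem toDual_apply (n : ℕ) (z : W n) (v : W1 n) :
    toDual n z v = ∑ i : Fin n, z (Sum.inr i) * v i := by
  simp [toDual]

/-- A vector of `W₁` acts on `⋀ W₁` by the exterior product, a vector of `W₂` by the interior
product. -/
def vectorAction (n : ℕ) : W n →ₗ[ℂ] Module.End ℂ (ExteriorAlgebra ℂ (W1 n)) :=
  LinearMap.mul ℂ (ExteriorAlgebra ℂ (W1 n)) ∘ₗ ExteriorAlgebra.ι ℂ ∘ₗ toW1 n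
    + contractLeft ∘ₗ toDual n

theorem vectorAction_apply (n : ℕ) (z : W n) (s : ExteriorAlgebra ℂ (W1 n)) :
    vectorAction n z s =
      ExteriorAlgebra.ι ℂ (toW1 n z) * s + contractLeft (toDual n z) s := rfl

theorem vectorAction_sq (n : ℕ) (z : W n) :
    vectorAction n z * vectorAction n z = algebraMap ℂ _ (Q n z) := by
  apply LinearMap.ext
  intro s
  have h1 : ExteriorAlgebra.ι ℂ (toW1 n z) * (ExteriorAlgebra.ι ℂ (toW1 n z) * s) = 0 := by
    rw [← mul_assoc, ExteriorAlgebra.ι_sq_zero, zero_mul]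
  have h2 : toDual n z (toW1 n z) = Q n z := by
    rw [toDual_apply, Q_apply]
    exact Finset.sum_congr rfl fun i _ => by simp [toW1, LinearMap.funLeft_apply, mul_comm]
  have h3 : contractLeft (toDual n z) (ExteriorAlgebra.ι ℂ (toW1 n z) * s)
      = toDual n z (toW1 n z) • s
        - ExteriorAlgebra.ι ℂ (toW1 n z) * contractLeft (toDual n z) s :=
    contractLeft_ι_mul _ _ _
  have h4 : contractLeft (toDual n z) (contractLeft (toDual n z) s) = 0 :=
    contractLeft_contractLeft _ _
  rw [Module.End.mul_apply, vectorAction_apply, vectorAction_apply, mul_add, map_add, h1, h3, h4,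
    h2, Module.algebraMap_end_apply]
  abel

/-- The algebra homomorphism `C(W, b) → End(⋀ W₁)`. -/
def cliffordAction (n : ℕ) : Cl n →ₐ[ℂ] Module.End ℂ (ExteriorAlgebra ℂ (W1 n)) :=
  CliffordAlgebra.lift (Q n) ⟨vectorAction n, vectorAction_sq n⟩

/-- The even part (`p = 0`) and the odd part (`p = 1`) of `⋀ W₁`. -/
def S (n : ℕ) (p : ZMod 2) : Submodule ℂ (ExteriorAlgebra ℂ (W1 n)) :=
  evenOdd (0 : QuadraticForm ℂ (W1 n)) p

theorem iota_mul_mem {n : ℕ} (v : W1 n) {p : ZMod 2} {s : ExteriorAlgebra ℂ (W1 n)}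
    (hs : s ∈ S n p) : ExteriorAlgebra.ι ℂ v * s ∈ S n (p + 1) := by
  rw [add_comm]
  exact evenOdd_mul_le _ _ _ (Submodule.mul_mem_mul (ι_mem_evenOdd_one _ v) hs)

theorem contractLeft_mem {n : ℕ} (d : Module.Dual ℂ (W1 n)) {p : ZMod 2}
    {s : ExteriorAlgebra ℂ (W1 n)} (hs : s ∈ S n p) : contractLeft d s ∈ S n (p + 1) := by
  have step : ∀ (q : ZMod 2) (m₁ m₂ : W1 n) (x : ExteriorAlgebra ℂ (W1 n)), x ∈ S n q →
      contractLeft d x ∈ S n (q + 1) →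
      contractLeft d (ExteriorAlgebra.ι ℂ m₁ * ExteriorAlgebra.ι ℂ m₂ * x) ∈ S n (q + 1) := by
    intro q m₁ m₂ x hx ih
    have h : contractLeft d (ExteriorAlgebra.ι ℂ m₁ * (ExteriorAlgebra.ι ℂ m₂ * x))
        = d m₁ • (ExteriorAlgebra.ι ℂ m₂ * x) - ExteriorAlgebra.ι ℂ m₁ *
          (d m₂ • x - ExteriorAlgebra.ι ℂ m₂ * contractLeft d x) := by
      rw [← contractLeft_ι_mul]
      exact contractLeft_ι_mul _ _ _
    rw [mul_assoc, h]
    have hq : q + 1 + 1 + 1 = q + 1 := by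
      rw [add_assoc q 1 1, show (1 : ZMod 2) + 1 = 0 from rfl, add_zero]
    have h1 := iota_mul_mem m₁ (iota_mul_mem m₂ ih)
    rw [hq] at h1
    rw [mul_sub, mul_smul_comm]
    exact sub_mem (Submodule.smul_mem _ _ (iota_mul_mem _ hx))
      (sub_mem (Submodule.smul_mem _ _ (iota_mul_mem _ hx)) h1)
  have hp : p = 0 ∨ p = 1 := by
    have : ∀ q : ZMod 2, q = 0 ∨ q = 1 := by decide
    exact this p
  rcases hp with rfl | rfl
  · have hs' : s ∈ evenOdd (0 : QuadraticForm ℂ (W1 n)) 0 := hs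
    clear hs
    induction s, hs' using even_induction with
    | algebraMap r =>
      rw [contractLeft_algebraMap]
      exact zero_mem _
    | add x y hx hy ihx ihy =>
      rw [map_add]
      exact add_mem ihx ihy
    | ι_mul_ι_mul m₁ m₂ x hx ih => exact step 0 m₁ m₂ x hx ih
  · have hs' : s ∈ evenOdd (0 : QuadraticForm ℂ (W1 n)) 1 := hs
    clear hs
    induction s, hs' using odd_induction with
    | ι v =>
      rw [contractLeft_ι]
      exact SetLike.algebraMap_mem_graded (evenOdd (0 : QuadraticForm ℂ (W1 n))) _
    | add x y hx hy ihx ihy =>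
      rw [map_add]
      exact add_mem ihx ihy
    | ι_mul_ι_mul m₁ m₂ x hx ih => exact step 1 m₁ m₂ x hx ih

theorem vectorAction_mem {n : ℕ} (z : W n) {p : ZMod 2} {s : ExteriorAlgebra ℂ (W1 n)}
    (hs : s ∈ S n p) : vectorAction n z s ∈ S n (p + 1) :=
  add_mem (iota_mul_mem _ hs) (contractLeft_mem _ hs)

theorem cliffordAction_mem {n : ℕ} {x : Cl n} (hx : x ∈ even (Q n)) {p : ZMod 2}
    {s : ExteriorAlgebra ℂ (W1 n)} (hs : s ∈ S n p) : cliffordAction n x s ∈ S n p := by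
  have hx' : x ∈ evenOdd (Q n) 0 := hx
  clear hx
  induction x, hx' using even_induction with
  | algebraMap r =>
    rw [AlgHom.commutes, Module.algebraMap_end_apply]
    exact Submodule.smul_mem _ _ hs
  | add x y hx hy ihx ihy =>
    rw [map_add]
    exact add_mem ihx ihy
  | ι_mul_ι_mul m₁ m₂ x hx ih =>
    have h := vectorAction_mem m₁ (vectorAction_mem m₂ ih)
    have hp : p + 1 + 1 = p := by
      rw [add_assoc, show (1 : ZMod 2) + 1 = 0 from rfl, add_zero]
    rw [hp] at h
    simpa [cliffordAction] using h

/-- The half spin representation of `Spin(W, b)` on `⋀^even W₁` (`p = 0`) or `⋀^odd W₁`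
(`p = 1`). -/
def halfSpin (n : ℕ) (p : ZMod 2) : Representation ℂ (Spin n) (S n p) where
  toFun x := (cliffordAction n (x : Cl n)).restrict
    (fun _ hs => cliffordAction_mem (spinGroup.mem_even x.2) hs)
  map_one' := by
    apply LinearMap.ext
    intro s
    apply Subtype.ext
    simp [LinearMap.restrict_apply]
  map_mul' x y := by
    apply LinearMap.ext
    intro s
    apply Subtype.ext
    simp [LinearMap.restrict_apply]

/-- The half spin representation `S⁺` of `Spin(W, b)`, on `⋀^even W₁`. -/
abbrev Splus (n : ℕ) : Representation ℂ (Spin n) (S n 0) := halfSpin n 0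

/-- The half spin representation `S⁻` of `Spin(W, b)`, on `⋀^odd W₁`. -/
abbrev Sminus (n : ℕ) : Representation ℂ (Spin n) (S n 1) := halfSpin n 1

/-! ### Representations defined over `ℝ` -/

/-- The restriction of a representation to a subgroup. -/
def res {G V : Type*} [Group G] [AddCommGroup V] [Module ℂ V] (π : Representation ℂ G V)
    (H : Subgroup G) : Representation ℂ H V :=
  π.comp H.subtype

/-- A complex representation of `G` can be defined over `ℝ` if it is isomorphic to the extension
of scalars `ℂ ⊗ V₀` of a real representation `V₀` of `G`. -/
def DefinedOverReal {G : Type*} {V : Type} [Group G] [AddCommGroup V] [Module ℂ V]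
    (π : Representation ℂ G V) : Prop :=
  ∃ (V₀ : Type) (_ : AddCommGroup V₀) (_ : Module ℝ V₀) (π₀ : Representation ℝ G V₀)
    (f : (ℂ ⊗[ℝ] V₀) ≃ₗ[ℂ] V),
    ∀ (g : G) (c : ℂ) (v : V₀), f (c ⊗ₜ[ℝ] π₀ g v) = π g (f (c ⊗ₜ[ℝ] v))

/-! ### The real groups -/

/-- `SO*(2n)`: the complex linear automorphisms of `W` of determinant `1` that preserve the
symmetric bilinear form `b` and the Hermitian form `ψ₀` of signature `(n, n)`. -/
def SOstar (n : ℕ) : Subgroup (LinearMap.GeneralLinearGroup ℂ (W n)) where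
  carrier := {g | LinearMap.det (g : W n →ₗ[ℂ] W n) = 1 ∧
    (∀ z w, b n (g.val z) (g.val w) = b n z w) ∧
    (∀ z w, psi0 n (g.val z) (g.val w) = psi0 n z w)}
  one_mem' := by simp
  mul_mem' := by
    rintro g h ⟨hg1, hg2, hg3⟩ ⟨hh1, hh2, hh3⟩
    refine ⟨?_, fun z w => ?_, fun z w => ?_⟩
    · rw [Units.val_mul, map_mul, hg1, hh1, one_mul]
    · rw [Units.val_mul, Module.End.mul_apply, Module.End.mul_apply, hg2, hh2]
    · rw [Units.val_mul, Module.End.mul_apply, Module.End.mul_apply, hg3, hh3]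
  inv_mem' := by
    rintro g ⟨hg1, hg2, hg3⟩
    have hinv : ∀ z, g.val ((g⁻¹).val z) = z := fun z => by
      rw [← Module.End.mul_apply, Units.mul_inv, Module.End.one_apply]
    refine ⟨?_, fun z w => ?_, fun z w => ?_⟩
    · have h := congrArg LinearMap.det (Units.mul_inv g)
      rw [map_mul, hg1, one_mul, map_one] at h
      exact h
    · rw [← hg2, hinv, hinv]
    · rw [← hg3, hinv, hinv]

/-- The diagonal sign matrix on `ℝ^{2n}` with `-1` in the positions `1, …, k` and
`n+1, …, n+k`, and `1` elsewhere: for `k ≤ n`, a symmetric form of signature `(2n-2k, 2k)`. -/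
def eta (n k : ℕ) : Matrix (Fin n ⊕ Fin n) (Fin n ⊕ Fin n) ℝ :=
  Matrix.diagonal (Sum.elim (fun i => if i.val < k then -1 else 1)
    (fun i => if i.val < k then -1 else 1))

/-- `SO(2n-2k, 2k)`: the real matrices of determinant `1` that preserve the symmetric form `eta` of
signature `(2n-2k, 2k)`. -/
def SOpq (n k : ℕ) : Subgroup (Matrix.SpecialLinearGroup (Fin n ⊕ Fin n) ℝ) where
  carrier := {A | (A : Matrix _ _ ℝ).transpose * eta n k * (A : Matrix _ _ ℝ) = eta n k}
  one_mem' := by simp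
  mul_mem' := by
    intro A B hA hB
    rw [Set.mem_ofPred_eq] at hA hB ⊢
    rw [Matrix.SpecialLinearGroup.coe_mul, Matrix.transpose_mul]
    calc _ = (B : Matrix _ _ ℝ).transpose *
          ((A : Matrix _ _ ℝ).transpose * eta n k * (A : Matrix _ _ ℝ)) * (B : Matrix _ _ ℝ) := by
          simp only [Matrix.mul_assoc]
      _ = _ := by rw [hA, hB]
  inv_mem' := by
    intro A hA
    rw [Set.mem_ofPred_eq] at hA ⊢
    have h1 := congrArg (fun X : Matrix.SpecialLinearGroup (Fin n ⊕ Fin n) ℝ =>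
      (X : Matrix (Fin n ⊕ Fin n) (Fin n ⊕ Fin n) ℝ)) (mul_inv_cancel A)
    simp only [Matrix.SpecialLinearGroup.coe_mul, Matrix.SpecialLinearGroup.coe_one] at h1
    generalize (↑(A⁻¹) : Matrix (Fin n ⊕ Fin n) (Fin n ⊕ Fin n) ℝ) = B at h1 ⊢
    have h2 : B.transpose * (A : Matrix _ _ ℝ).transpose = 1 := by
      rw [← Matrix.transpose_mul, h1, Matrix.transpose_one]
    calc _ = B.transpose * ((A : Matrix _ _ ℝ).transpose * eta n k * (A : Matrix _ _ ℝ)) * B := by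
          rw [hA]
      _ = (B.transpose * (A : Matrix _ _ ℝ).transpose) * eta n k * ((A : Matrix _ _ ℝ) * B) := by
          simp only [Matrix.mul_assoc]
      _ = _ := by rw [h1, h2, Matrix.one_mul, Matrix.mul_one]

/-- A basis of `W` in which `b` has the real matrix `2 • eta`, so that its real span is a real
quadratic space of signature `(2n-2k, 2k)` with complexification `(W, b)`. -/
def realBasis (n k : ℕ) : Fin n ⊕ Fin n → W n
  | Sum.inl i => if i.val < k then Complex.I • (e n (Sum.inl i) + e n (Sum.inr i))
      else e n (Sum.inl i) + e n (Sum.inr i)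
  | Sum.inr i => if i.val < k then e n (Sum.inl i) - e n (Sum.inr i)
      else Complex.I • (e n (Sum.inl i) - e n (Sum.inr i))

theorem b_realBasis (n k : ℕ) (r s : Fin n ⊕ Fin n) :
    b n (realBasis n k r) (realBasis n k s) = ((2 * eta n k r s : ℝ) : ℂ) := by
  have hI := Complex.I_mul_I
  have hb : ∀ (x y u v : ℂ) (i j : Fin n),
      b n (x • e n (Sum.inl i) + y • e n (Sum.inr i)) (u • e n (Sum.inl j) + v • e n (Sum.inr j))
        = if i = j then x * v + y * u else 0 := by
    intro x y u v i j
    simp only [b, e, Pi.add_apply, Pi.smul_apply, smul_eq_mul, Pi.single_apply,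
      Sum.inl.injEq, Sum.inr.injEq, reduceCtorEq, if_false, mul_zero, add_zero, zero_add, mul_ite,
      mul_one]
    by_cases hij : i = j
    · subst hij
      rw [Finset.sum_eq_single i]
      · simp
      · intro c _ hc
        simp [hc]
      · simp
    · rw [if_neg hij]
      refine Finset.sum_eq_zero fun c _ => ?_
      by_cases hc : c = i
      · subst hc
        simp [hij]
      · simp [hc]
  have hl : ∀ i : Fin n, realBasis n k (Sum.inl i) =
      (if i.val < k then Complex.I else 1) • e n (Sum.inl i)
        + (if i.val < k then Complex.I else 1) • e n (Sum.inr i) := by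
    intro i
    by_cases h : i.val < k <;> simp [realBasis, h]
  have hr : ∀ i : Fin n, realBasis n k (Sum.inr i) =
      (if i.val < k then 1 else Complex.I) • e n (Sum.inl i)
        + (if i.val < k then -1 else -Complex.I) • e n (Sum.inr i) := by
    intro i
    by_cases h : i.val < k <;> simp [realBasis, h, sub_eq_add_neg]
  rcases r with i | i <;> rcases s with j | j <;> simp only [hl, hr, hb] <;>
    by_cases hij : i = j
  all_goals first
    | (subst hij; by_cases h : i.val < k <;> simp [eta, h] <;> norm_num)
    | simp [eta, hij]

/-- `SO(2n-2k, 2k)` as a group of complex linear automorphisms of `W`: the automorphisms whose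
matrix in the basis `realBasis` is real and lies in `SO(2n-2k, 2k)`. -/
def SOpqOnW (n k : ℕ) : Subgroup (LinearMap.GeneralLinearGroup ℂ (W n)) where
  carrier := {g | ∃ A ∈ SOpq n k, ∀ s, g.val (realBasis n k s) =
    ∑ r, (((A : Matrix _ _ ℝ) r s : ℝ) : ℂ) • realBasis n k r}
  one_mem' := by
    refine ⟨1, one_mem _, fun s => ?_⟩
    simp [Matrix.one_apply]
  mul_mem' := by
    rintro g h ⟨A, hA, hgA⟩ ⟨B, hB, hhB⟩
    refine ⟨A * B, mul_mem hA hB, fun s => ?_⟩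
    rw [Units.val_mul, Module.End.mul_apply, hhB, map_sum]
    simp only [map_smul, hgA, Finset.smul_sum, smul_smul]
    rw [Finset.sum_comm]
    refine Finset.sum_congr rfl fun r _ => ?_
    rw [← Finset.sum_smul, Matrix.SpecialLinearGroup.coe_mul, Matrix.mul_apply]
    push_cast
    congr 1
    exact Finset.sum_congr rfl fun t _ => mul_comm _ _
  inv_mem' := by
    rintro g ⟨A, hA, hgA⟩
    refine ⟨A⁻¹, inv_mem hA, fun s => ?_⟩
    have hinv : ∀ z, (g⁻¹).val (g.val z) = z := fun z => by
      rw [← Module.End.mul_apply, Units.inv_mul, Module.End.one_apply]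
    have h1 := congrArg (fun X : Matrix.SpecialLinearGroup (Fin n ⊕ Fin n) ℝ =>
      (X : Matrix (Fin n ⊕ Fin n) (Fin n ⊕ Fin n) ℝ)) (mul_inv_cancel A)
    simp only [Matrix.SpecialLinearGroup.coe_mul, Matrix.SpecialLinearGroup.coe_one] at h1
    generalize (↑(A⁻¹) : Matrix (Fin n ⊕ Fin n) (Fin n ⊕ Fin n) ℝ) = B at h1 ⊢
    have h2 : ∀ r, ∑ t, ((B t s : ℝ) : ℂ) * (((A : Matrix _ _ ℝ) r t : ℝ) : ℂ)
        = if r = s then 1 else 0 := fun r => by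
      have h3 := congrFun (congrFun h1 r) s
      rw [Matrix.mul_apply, Matrix.one_apply] at h3
      have h4 := congrArg (fun x : ℝ => (x : ℂ)) h3
      push_cast at h4
      simp only [mul_comm ((B _ s : ℝ) : ℂ)]
      rw [h4]
      split_ifs <;> simp
    have h : g.val (∑ r, ((B r s : ℝ) : ℂ) • realBasis n k r) = realBasis n k s := by
      rw [map_sum]
      simp only [map_smul, hgA, Finset.smul_sum, smul_smul]
      rw [Finset.sum_comm]
      simp only [← Finset.sum_smul, h2]
      simp
    have h5 := hinv (∑ r, ((B r s : ℝ) : ℂ) • realBasis n k r)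
    rw [h] at h5
    exact h5

end HalfSpin

end

noncomputable section

namespace HalfSpin

/-! ### Conjugate-linear homomorphisms out of a Clifford algebra -/

/-- A complex algebra with its scalar multiplication precomposed with complex conjugation. -/
def ConjAlgebra (A : Type*) : Type _ := A

instance (A : Type*) [Ring A] : Ring (ConjAlgebra A) := inferInstanceAs (Ring A)

instance (A : Type*) [Ring A] [Algebra ℂ A] : Algebra ℂ (ConjAlgebra A) :=
  RingHom.toAlgebra' (S := ConjAlgebra A) ((algebraMap ℂ A).comp (starRingEnd ℂ))
    fun c x => Algebra.commutes (A := A) (starRingEnd ℂ c) x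

/-- The conjugate-linear ring homomorphism out of a Clifford algebra that extends a conjugate-linear
map `f` with `f v ^ 2 = conj (q v)`. -/
def semilinearLift {V A : Type*} [AddCommGroup V] [Module ℂ V] [Ring A] [Algebra ℂ A]
    (q : QuadraticForm ℂ V) (f : V →ₛₗ[starRingEnd ℂ] A)
    (hf : ∀ v, f v * f v = algebraMap ℂ A (starRingEnd ℂ (q v))) : CliffordAlgebra q →+* A :=
  (CliffordAlgebra.lift q (A := ConjAlgebra A)
    ⟨{ toFun := f
       map_add' := map_add f
       map_smul' := fun c v => by
        exact (map_smulₛₗ f c v).trans (Algebra.smul_def _ _) }, hf⟩).toRingHom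

section SemilinearLift

variable {V A : Type*} [AddCommGroup V] [Module ℂ V] [Ring A] [Algebra ℂ A]
    (q : QuadraticForm ℂ V) (f : V →ₛₗ[starRingEnd ℂ] A)
    (hf : ∀ v, f v * f v = algebraMap ℂ A (starRingEnd ℂ (q v)))

theorem semilinearLift_ι (v : V) : semilinearLift q f hf (ι q v) = f v :=
  CliffordAlgebra.lift_ι_apply (A := ConjAlgebra A) _ _ v

theorem semilinearLift_algebraMap (c : ℂ) :
    semilinearLift q f hf (algebraMap ℂ _ c) = algebraMap ℂ A (starRingEnd ℂ c) :=
  AlgHom.commutes (CliffordAlgebra.lift q (A := ConjAlgebra A) _) c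

theorem semilinearLift_smul (c : ℂ) (x : CliffordAlgebra q) :
    semilinearLift q f hf (c • x) = starRingEnd ℂ c • semilinearLift q f hf x := by
  rw [Algebra.smul_def, map_mul, semilinearLift_algebraMap, Algebra.smul_def]

end SemilinearLift

/-! ### Elements annihilated by all contractions -/

/-- The Euler operator of an exterior algebra: multiplication by `k` in degree `k`. -/
def euler (κ : Type*) [Fintype κ] [DecidableEq κ] :
    Module.End ℂ (ExteriorAlgebra ℂ (κ → ℂ)) :=
  ∑ r : κ, LinearMap.mulLeft ℂ (ExteriorAlgebra.ι ℂ (Pi.single r (1 : ℂ)))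
    ∘ₗ contractLeft (LinearMap.proj r : Module.Dual ℂ (κ → ℂ))

section Euler

variable {κ : Type*} [Fintype κ] [DecidableEq κ]

theorem euler_apply (x : ExteriorAlgebra ℂ (κ → ℂ)) : euler κ x =
    ∑ r : κ, ExteriorAlgebra.ι ℂ (Pi.single r (1 : ℂ)) *
      contractLeft (LinearMap.proj r : Module.Dual ℂ (κ → ℂ)) x := by
  simp [euler, LinearMap.sum_apply]

theorem exterior_contractLeft_ι_mul {M : Type*} [AddCommGroup M] [Module ℂ M]
    (d : Module.Dual ℂ M) (v : M) (x : ExteriorAlgebra ℂ M) :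
    contractLeft d (ExteriorAlgebra.ι ℂ v * x)
      = d v • x - ExteriorAlgebra.ι ℂ v * contractLeft d x :=
  contractLeft_ι_mul _ _ _

theorem exterior_ι_mul_ι_swap {M : Type*} [AddCommGroup M] [Module ℂ M] (v w : M) :
    ExteriorAlgebra.ι ℂ v * ExteriorAlgebra.ι ℂ w
      = -(ExteriorAlgebra.ι ℂ w * ExteriorAlgebra.ι ℂ v) :=
  eq_neg_of_add_eq_zero_left (ExteriorAlgebra.ι_add_mul_swap v w)

theorem euler_ι_mul (v : κ → ℂ) (x : ExteriorAlgebra ℂ (κ → ℂ)) :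
    euler κ (ExteriorAlgebra.ι ℂ v * x)
      = ExteriorAlgebra.ι ℂ v * x + ExteriorAlgebra.ι ℂ v * euler κ x := by
  simp only [euler_apply, exterior_contractLeft_ι_mul, mul_sub, Finset.sum_sub_distrib,
    LinearMap.proj_apply, Finset.mul_sum, ← mul_assoc]
  rw [sub_eq_add_neg, ← Finset.sum_neg_distrib]
  congr 1
  · conv_rhs => rw [pi_eq_sum_univ' v]
    simp only [mul_smul_comm, map_sum, Finset.sum_mul]
    refine Finset.sum_congr rfl fun r _ => ?_
    rw [← smul_mul_assoc, ← map_smul]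
  · refine Finset.sum_congr rfl fun r _ => ?_
    rw [exterior_ι_mul_ι_swap v, neg_mul]

theorem euler_of_mem {k : ℕ} {x : ExteriorAlgebra ℂ (κ → ℂ)} (hx : x ∈ ⋀[ℂ]^k (κ → ℂ)) :
    euler κ x = (k : ℂ) • x := by
  induction hx using Submodule.pow_induction_on_left' with
  | algebraMap r =>
    rw [euler_apply]
    simp only [CharP.cast_eq_zero, zero_smul]
    exact Finset.sum_eq_zero fun r _ => by
      erw [contractLeft_algebraMap]
      simp
  | add x y i hx hy ihx ihy => rw [map_add, ihx, ihy, smul_add]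
  | mem_mul v hv i x hx ih =>
    obtain ⟨v, rfl⟩ := hv
    rw [euler_ι_mul, ih, mul_smul_comm]
    push_cast
    rw [add_smul, one_smul, add_comm]

/-- An element of an exterior algebra annihilated by all contractions is a scalar. -/
theorem exists_algebraMap_of_contractLeft_eq_zero {x : ExteriorAlgebra ℂ (κ → ℂ)}
    (hx : ∀ d : Module.Dual ℂ (κ → ℂ), contractLeft d x = 0) :
    ∃ c : ℂ, x = algebraMap ℂ _ c := by
  classical
  have h0 : euler κ x = 0 := by
    rw [euler_apply]
    exact Finset.sum_eq_zero fun r _ => by rw [hx, mul_zero]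
  let D := DirectSum.decompose (fun i : ℕ => ⋀[ℂ]^i (κ → ℂ)) x
  have hsum : ∑ i ∈ D.support, (D i : ExteriorAlgebra ℂ (κ → ℂ)) = x :=
    DirectSum.sum_support_decompose (fun i : ℕ => ⋀[ℂ]^i (κ → ℂ)) x
  have h1 : ∑ i ∈ D.support, (((i : ℂ) • D i : ⋀[ℂ]^i (κ → ℂ)) : ExteriorAlgebra ℂ (κ → ℂ))
      = 0 := by
    rw [← h0, ← hsum, map_sum]
    exact Finset.sum_congr rfl fun i _ => by
      rw [euler_of_mem (D i).2]; rfl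
  have h2 : ∀ i, i ≠ 0 → D i = 0 := by
    intro i hi
    have h3 := congrArg (fun y => DirectSum.decompose (fun i : ℕ => ⋀[ℂ]^i (κ → ℂ)) y i) h1
    simp only [DirectSum.decompose_sum, DirectSum.decompose_coe, DirectSum.decompose_zero] at h3
    rw [DFinsupp.finsetSum_apply] at h3
    by_contra hne
    rw [Finset.sum_eq_single i, DirectSum.of_eq_same] at h3
    · have : (i : ℂ) ≠ 0 := by exact_mod_cast hi
      exact hne ((smul_eq_zero.1 h3).resolve_left this)
    · intro j _ hj
      exact DirectSum.of_eq_of_ne _ _ _ hj.symm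
    · intro hn
      exact absurd (by simpa using hn) hne
  have h4 : x = D 0 := by
    rw [← hsum]
    by_cases h : D 0 = 0
    · rw [h]
      exact Finset.sum_eq_zero fun i _ => by
        rcases eq_or_ne i 0 with rfl | hi
        · rw [h]; rfl
        · rw [h2 i hi]; rfl
    · refine Finset.sum_eq_single 0 (fun i _ hi => by rw [h2 i hi]; rfl) fun hn => ?_
      exact absurd (by simpa using hn) h
  have h5 : ∀ y ∈ ⋀[ℂ]^0 (κ → ℂ), ∃ c : ℂ, algebraMap ℂ _ c = y := by
    intro y hy
    rwa [show ⋀[ℂ]^0 (κ → ℂ) = 1 from pow_zero _, Submodule.mem_one] at hy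
  obtain ⟨c, hc⟩ := h5 _ (D 0).2
  exact ⟨c, h4.trans hc.symm⟩

/-- An element of a Clifford algebra annihilated by all contractions is a scalar. -/
theorem clifford_exists_algebraMap_of_contractLeft_eq_zero {q : QuadraticForm ℂ (κ → ℂ)}
    {x : CliffordAlgebra q} (hx : ∀ d : Module.Dual ℂ (κ → ℂ), contractLeft d x = 0) :
    ∃ c : ℂ, x = algebraMap ℂ _ c := by
  have h : ∀ d : Module.Dual ℂ (κ → ℂ), contractLeft d (equivExterior q x) = 0 := by
    intro d
    rw [equivExterior, changeFormEquiv_apply]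
    have := (changeForm_contractLeft (changeForm.associated_neg_proof (Q := q)) d x)
    erw [← this]
    rw [hx, map_zero]
  obtain ⟨c, hc⟩ := exists_algebraMap_of_contractLeft_eq_zero h
  refine ⟨c, (equivExterior q).injective ?_⟩
  rw [hc, equivExterior, changeFormEquiv_apply]
  exact (changeForm_algebraMap _ c).symm

end Euler

/-- Even elements of a Clifford algebra satisfy `v x - x v = b(v, ·) ⌋ x`. -/
theorem ι_mul_sub_mul_ι {n : ℕ} (v : W n) {x : Cl n} (hx : x ∈ evenOdd (Q n) 0) :
    ι (Q n) v * x - x * ι (Q n) v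
      = contractLeft ((QuadraticMap.polarBilin (Q n)) v) x := by
  induction x, hx using even_induction with
  | algebraMap r => rw [contractLeft_algebraMap, Algebra.commutes, sub_self]
  | add x y hx hy ihx ihy => rw [map_add, ← ihx, ← ihy]; noncomm_ring
  | ι_mul_ι_mul m₁ m₂ x hx ih =>
    rw [mul_assoc, contractLeft_ι_mul, contractLeft_ι_mul, ← ih]
    have h : ∀ m, ((QuadraticMap.polarBilin (Q n)) v m) • (1 : Cl n)
        = ι (Q n) v * ι (Q n) m + ι (Q n) m * ι (Q n) v := fun m => by
      rw [ι_mul_ι_add_swap, Algebra.algebraMap_eq_smul_one]; rfl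
    have h1 : ∀ m (y : Cl n), ((QuadraticMap.polarBilin (Q n)) v m) • y
        = (ι (Q n) v * ι (Q n) m + ι (Q n) m * ι (Q n) v) * y := fun m y => by
      rw [← h, smul_mul_assoc, one_mul]
    rw [h1, h1]
    noncomm_ring

theorem b_comm {n : ℕ} (z w : W n) : b n z w = b n w z := by
  simp only [b]
  exact Finset.sum_congr rfl fun i _ => by ring

theorem b_e_inl {n : ℕ} (i : Fin n) (z : W n) : b n (e n (Sum.inl i)) z = z (Sum.inr i) := by
  simp [b, e, Pi.single_apply]

theorem b_e_inr {n : ℕ} (i : Fin n) (z : W n) : b n (e n (Sum.inr i)) z = z (Sum.inl i) := by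
  simp [b, e, Pi.single_apply]

/-- An even element of `C(W, b)` that commutes with all vectors is a scalar. -/
theorem exists_algebraMap_of_commute {n : ℕ} {x : Cl n} (hx : x ∈ even (Q n))
    (hc : ∀ w, ι (Q n) w * x = x * ι (Q n) w) : ∃ c : ℂ, x = algebraMap ℂ _ c := by
  refine clifford_exists_algebraMap_of_contractLeft_eq_zero fun d => ?_
  have hd : d = QuadraticMap.polarBilin (Q n)
      (Sum.elim (fun i => d (e n (Sum.inr i))) (fun i => d (e n (Sum.inl i)))) := by
    refine LinearMap.pi_ext' fun r => LinearMap.ext_ring ?_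
    change d (e n r) = QuadraticMap.polar (Q n) _ (e n r)
    rw [polar_Q, b_comm]
    rcases r with i | i
    · rw [b_e_inl]; rfl
    · rw [b_e_inr]; rfl
  rw [hd, ← ι_mul_sub_mul_ι _ hx, hc, sub_self]

/-! ### Conjugate-linear isometries of `W` and their action on the Clifford algebra -/

/-- The conjugate-linear map of `W` with `e_i ↦ a_i e_{n+i}` and `e_{n+i} ↦ conj(a_i) e_i`. -/
def tau {n : ℕ} (a : Fin n → ℂ) : W n →ₛₗ[starRingEnd ℂ] W n where
  toFun z := Sum.elim (fun i => starRingEnd ℂ (a i) * starRingEnd ℂ (z (Sum.inr i)))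
    (fun i => a i * starRingEnd ℂ (z (Sum.inl i)))
  map_add' z w := by ext (i | i) <;> simp [mul_add]
  map_smul' c z := by ext (i | i) <;> simp <;> ring

theorem tau_inl {n : ℕ} (a : Fin n → ℂ) (z : W n) (i : Fin n) :
    tau a z (Sum.inl i) = starRingEnd ℂ (a i) * starRingEnd ℂ (z (Sum.inr i)) := rfl

theorem tau_inr {n : ℕ} (a : Fin n → ℂ) (z : W n) (i : Fin n) :
    tau a z (Sum.inr i) = a i * starRingEnd ℂ (z (Sum.inl i)) := rfl

/-- A family of complex numbers of absolute value `1`. -/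
def Unimodular {n : ℕ} (a : Fin n → ℂ) : Prop := ∀ i, a i * starRingEnd ℂ (a i) = 1

theorem b_tau {n : ℕ} {a : Fin n → ℂ} (ha : Unimodular a) (z w : W n) :
    b n (tau a z) (tau a w) = starRingEnd ℂ (b n z w) := by
  simp only [b, tau_inl, tau_inr, map_sum, map_add, map_mul]
  refine Finset.sum_congr rfl fun i _ => ?_
  linear_combination (starRingEnd ℂ (z (Sum.inr i)) * starRingEnd ℂ (w (Sum.inl i)) +
    starRingEnd ℂ (z (Sum.inl i)) * starRingEnd ℂ (w (Sum.inr i))) * ha i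

theorem Q_tau {n : ℕ} {a : Fin n → ℂ} (ha : Unimodular a) (z : W n) :
    Q n (tau a z) = starRingEnd ℂ (Q n z) := by
  simp only [Q_apply, tau_inl, tau_inr, map_sum, map_mul]
  refine Finset.sum_congr rfl fun i _ => ?_
  linear_combination (starRingEnd ℂ (z (Sum.inr i)) * starRingEnd ℂ (z (Sum.inl i))) * ha i

theorem tau_tau {n : ℕ} {a : Fin n → ℂ} {δ : ℝ} (hδ : ∀ i, a i ^ 2 = δ) (z : W n) :
    tau a (tau a z) = (δ : ℂ) • z := by
  have hδ' : ∀ i, starRingEnd ℂ (a i) ^ 2 = δ := fun i => by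
    rw [← map_pow, hδ, Complex.conj_ofReal]
  ext (i | i)
  · simp only [tau_inl, tau_inr, map_mul, Complex.conj_conj, Pi.smul_apply, smul_eq_mul]
    linear_combination z (Sum.inl i) * hδ' i
  · simp only [tau_inl, tau_inr, map_mul, Complex.conj_conj, Pi.smul_apply, smul_eq_mul]
    linear_combination z (Sum.inr i) * hδ i

/-- The conjugate-linear ring endomorphism of `C(W, b)` that extends `tau a`. -/
def theta {n : ℕ} {a : Fin n → ℂ} (ha : Unimodular a) : Cl n →+* Cl n :=
  semilinearLift (Q n) ((ι (Q n)).comp (tau a)) fun v => by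
    rw [LinearMap.comp_apply, ι_sq_scalar, Q_tau ha]

section Theta

variable {n : ℕ} {a : Fin n → ℂ} (ha : Unimodular a)

theorem theta_ι (v : W n) : theta ha (ι (Q n) v) = ι (Q n) (tau a v) :=
  semilinearLift_ι _ _ _ _

theorem theta_algebraMap (c : ℂ) :
    theta ha (algebraMap ℂ _ c) = algebraMap ℂ _ (starRingEnd ℂ c) :=
  semilinearLift_algebraMap _ _ _ _

theorem theta_smul (c : ℂ) (x : Cl n) : theta ha (c • x) = starRingEnd ℂ c • theta ha x :=
  semilinearLift_smul _ _ _ _ _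

theorem theta_star (x : Cl n) : theta ha (star x) = star (theta ha x) := by
  induction x using CliffordAlgebra.induction with
  | algebraMap r => simp [theta_algebraMap]
  | ι v => simp [theta_ι]
  | mul x y hx hy => rw [star_mul, map_mul, hx, hy, map_mul, star_mul]
  | add x y hx hy => rw [star_add, map_add, hx, hy, map_add, star_add]

theorem theta_mem_even {x : Cl n} (hx : x ∈ even (Q n)) : theta ha x ∈ even (Q n) := by
  have hx' : x ∈ evenOdd (Q n) 0 := hx
  clear hx
  induction x, hx' using even_induction with
  | algebraMap r => rw [theta_algebraMap]; exact Subalgebra.algebraMap_mem _ _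
  | add x y hx hy ihx ihy => rw [map_add]; exact add_mem ihx ihy
  | ι_mul_ι_mul u v x hx ih =>
    rw [map_mul, map_mul, theta_ι, theta_ι]
    exact mul_mem (ι_mul_ι_mem_evenOdd_zero (Q n) _ _) ih

end Theta

/-! ### The Clifford module -/

section Module

variable {n : ℕ}

theorem cliffordAction_ι (z : W n) : cliffordAction n (ι (Q n) z) = vectorAction n z :=
  lift_ι_apply _ _ _

theorem vectorAction_add_swap (u v : W n) (s : ExteriorAlgebra ℂ (W1 n)) :
    vectorAction n u (vectorAction n v s) + vectorAction n v (vectorAction n u s)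
      = b n u v • s := by
  have h := congrArg (fun x => cliffordAction n x s) (ι_mul_ι_add_swap (Q := Q n) u v)
  simpa [cliffordAction_ι, polar_Q] using h

theorem vectorAction_vectorAction_self (u : W n) (s : ExteriorAlgebra ℂ (W1 n)) :
    vectorAction n u (vectorAction n u s) = Q n u • s := by
  have h := congrArg (fun f => f s) (vectorAction_sq n u)
  simpa using h

theorem vectorAction_inl (v : W1 n) (s : ExteriorAlgebra ℂ (W1 n)) :
    vectorAction n (Sum.elim v 0) s = ExteriorAlgebra.ι ℂ v * s := by
  rw [vectorAction_apply]
  have h1 : toW1 n (Sum.elim v 0) = v := by ext i; simp [toW1, LinearMap.funLeft_apply]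
  have h2 : toDual n (Sum.elim v 0) = 0 := by
    apply LinearMap.ext; intro x; simp [toDual_apply]
  rw [h1, h2, map_zero, LinearMap.zero_apply, add_zero]

theorem vectorAction_one (z : W n) :
    vectorAction n z 1 = ExteriorAlgebra.ι ℂ (toW1 n z) := by
  rw [vectorAction_apply, mul_one]
  erw [contractLeft_one]
  rw [add_zero]

theorem one_mem_S : (1 : ExteriorAlgebra ℂ (W1 n)) ∈ S n 0 :=
  SetLike.GradedOne.one_mem (A := evenOdd (0 : QuadraticForm ℂ (W1 n)))

/-- An induction principle for the even part of `⋀ W₁`. -/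
theorem S_zero_induction {P : ExteriorAlgebra ℂ (W1 n) → Prop} (smul_one : ∀ c : ℂ, P (c • 1))
    (add : ∀ x y, P x → P y → P (x + y))
    (vec : ∀ u v x, P x → P (vectorAction n u (vectorAction n v x)))
    {s : ExteriorAlgebra ℂ (W1 n)} (hs : s ∈ S n 0) : P s := by
  have hs' : s ∈ evenOdd (0 : QuadraticForm ℂ (W1 n)) 0 := hs
  clear hs
  induction s, hs' using even_induction with
  | algebraMap r => rw [Algebra.algebraMap_eq_smul_one]; exact smul_one r
  | add x y hx hy ihx ihy => exact add x y ihx ihy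
  | ι_mul_ι_mul m₁ m₂ x hx ih =>
    have h := vec (Sum.elim m₁ 0) (Sum.elim m₂ 0) x ih
    rw [vectorAction_inl, vectorAction_inl, ← mul_assoc] at h
    exact h

end Module

/-! ### The conjugate-linear intertwiner -/

/-- Coordinatewise complex conjugation. -/
def conjPi (κ : Type*) : (κ → ℂ) →ₛₗ[starRingEnd ℂ] (κ → ℂ) where
  toFun z r := starRingEnd ℂ (z r)
  map_add' z w := by ext; simp
  map_smul' c z := by ext; simp

theorem conjPi_apply {κ : Type*} (z : κ → ℂ) (r : κ) : conjPi κ z r = starRingEnd ℂ (z r) := rfl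

/-- Complex conjugation of `⋀ W₁`. -/
def conjExterior (n : ℕ) : ExteriorAlgebra ℂ (W1 n) →+* ExteriorAlgebra ℂ (W1 n) :=
  semilinearLift (0 : QuadraticForm ℂ (W1 n)) ((ExteriorAlgebra.ι ℂ).comp (conjPi (Fin n)))
    fun v => by
      rw [LinearMap.comp_apply]
      erw [ExteriorAlgebra.ι_sq_zero]
      simp

theorem conjExterior_ι {n : ℕ} (v : W1 n) :
    conjExterior n (ExteriorAlgebra.ι ℂ v) = ExteriorAlgebra.ι ℂ (conjPi _ v) :=
  semilinearLift_ι _ _ _ _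

theorem conjExterior_smul {n : ℕ} (c : ℂ) (s : ExteriorAlgebra ℂ (W1 n)) :
    conjExterior n (c • s) = starRingEnd ℂ c • conjExterior n s :=
  semilinearLift_smul _ _ _ _ _

theorem conjExterior_contractLeft {n : ℕ} (z : W n) (s : ExteriorAlgebra ℂ (W1 n)) :
    conjExterior n (contractLeft (toDual n z) s)
      = contractLeft (toDual n (conjPi _ z)) (conjExterior n s) := by
  have hd : ∀ v, toDual n (conjPi _ z) (conjPi _ v) = starRingEnd ℂ (toDual n z v) := fun v => by
    simp [toDual_apply, conjPi_apply]
  induction s using CliffordAlgebra.left_induction with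
  | algebraMap r =>
    have h : conjExterior n (algebraMap ℂ _ r) = algebraMap ℂ _ (starRingEnd ℂ r) :=
      semilinearLift_algebraMap _ _ _ _
    rw [contractLeft_algebraMap]
    erw [h, contractLeft_algebraMap]
    rw [map_zero]
  | add x y hx hy => rw [map_add, map_add, map_add, hx, hy, map_add]
  | ι_mul x v hx =>
    change conjExterior n (contractLeft (toDual n z) (ExteriorAlgebra.ι ℂ v * x))
      = contractLeft (toDual n (conjPi _ z)) (conjExterior n (ExteriorAlgebra.ι ℂ v * x))
    rw [exterior_contractLeft_ι_mul, map_sub, conjExterior_smul, map_mul, map_mul, hx,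
      conjExterior_ι, exterior_contractLeft_ι_mul, hd]

theorem conjExterior_vectorAction {n : ℕ} (z : W n) (s : ExteriorAlgebra ℂ (W1 n)) :
    conjExterior n (vectorAction n z s) = vectorAction n (conjPi _ z) (conjExterior n s) := by
  rw [vectorAction_apply, map_add, map_mul, conjExterior_ι, conjExterior_contractLeft]
  rfl

/-- The vector `e_i - a_i e_{n+i}`. -/
def flipVec {n : ℕ} (a : Fin n → ℂ) (i : Fin n) : W n := e n (Sum.inl i) - a i • e n (Sum.inr i)

/-- The ordered product of the vectors `e_i - a_i e_{n+i}` over a list of indices. -/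
def flipProd {n : ℕ} (a : Fin n → ℂ) (l : List (Fin n)) : Cl n :=
  (l.map fun i => ι (Q n) (flipVec a i)).prod

section Flip

variable {n : ℕ} {a : Fin n → ℂ}

theorem flipProd_cons (i : Fin n) (l : List (Fin n)) :
    flipProd a (i :: l) = ι (Q n) (flipVec a i) * flipProd a l := by simp [flipProd]

theorem ι_mul_ι_of_b_eq_zero {u v : W n} (h : b n u v = 0) :
    ι (Q n) u * ι (Q n) v = -(ι (Q n) v * ι (Q n) u) := by
  rw [eq_neg_iff_add_eq_zero, ι_mul_ι_add_swap, polar_Q, h, map_zero]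

theorem b_flipVec (i : Fin n) (z : W n) :
    b n (flipVec a i) z = z (Sum.inr i) - a i * z (Sum.inl i) := by
  have : b n (flipVec a i) z = b n (e n (Sum.inl i)) z - a i * b n (e n (Sum.inr i)) z := by
    simp only [b, flipVec, Finset.mul_sum, ← Finset.sum_sub_distrib, Pi.sub_apply, Pi.smul_apply,
      smul_eq_mul]
    exact Finset.sum_congr rfl fun j _ => by ring
  rw [this, b_e_inl, b_e_inr]

theorem flipProd_mul_ι_of_notMem {l : List (Fin n)} {z : W n}
    (hz : ∀ i ∈ l, b n (flipVec a i) z = 0) :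
    flipProd a l * ι (Q n) z = (-1) ^ l.length * (ι (Q n) z * flipProd a l) := by
  induction l with
  | nil => simp [flipProd]
  | cons i l ih =>
    rw [flipProd_cons, mul_assoc, ih fun j hj => hz j (List.mem_cons_of_mem _ hj),
      List.length_cons, pow_succ]
    have h := ι_mul_ι_of_b_eq_zero (hz i List.mem_cons_self)
    have hc : ι (Q n) (flipVec a i) * (-1) ^ l.length = (-1) ^ l.length * ι (Q n) (flipVec a i) :=
      ((Commute.neg_one_right _).pow_right _).eq
    rw [← mul_assoc, hc, mul_assoc, ← mul_assoc (ι (Q n) (flipVec a i)), h]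
    noncomm_ring

theorem flipProd_mul_ι_of_mem {l : List (Fin n)} (hl : l.Nodup) {z w : W n} {j : Fin n}
    (hj : j ∈ l) (hz : ∀ i, i ≠ j → b n (flipVec a i) z = 0)
    (hw : ∀ i, i ≠ j → b n (flipVec a i) w = 0)
    (hzw : ι (Q n) (flipVec a j) * ι (Q n) z = -(ι (Q n) w * ι (Q n) (flipVec a j))) :
    flipProd a l * ι (Q n) z = (-1) ^ l.length * (ι (Q n) w * flipProd a l) := by
  induction l with
  | nil => simp at hj
  | cons i l ih =>
    have hc : ι (Q n) (flipVec a i) * (-1) ^ l.length = (-1) ^ l.length * ι (Q n) (flipVec a i) :=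
      ((Commute.neg_one_right _).pow_right _).eq
    rw [List.nodup_cons] at hl
    rcases eq_or_ne i j with rfl | hij
    · rw [flipProd_cons, mul_assoc, flipProd_mul_ι_of_notMem, List.length_cons, pow_succ,
        ← mul_assoc, hc, mul_assoc, ← mul_assoc (ι (Q n) (flipVec a i)), hzw]
      · noncomm_ring
      · intro k hk
        exact hz k (by rintro rfl; exact hl.1 hk)
    · have hj' : j ∈ l := (List.mem_cons.1 hj).resolve_left hij.symm
      rw [flipProd_cons, mul_assoc, ih hl.2 hj', List.length_cons, pow_succ,
        ← mul_assoc, hc, mul_assoc, ← mul_assoc (ι (Q n) (flipVec a i)),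
        ι_mul_ι_of_b_eq_zero (hw i hij)]
      noncomm_ring

theorem tau_conjPi_e_inl (j : Fin n) :
    tau a (conjPi _ (e n (Sum.inl j))) = a j • e n (Sum.inr j) := by
  ext (i | i)
  · simp [tau_inl, conjPi_apply, e]
  · by_cases h : i = j
    · subst h; simp [tau_inr, conjPi_apply, e]
    · simp [tau_inr, conjPi_apply, e, h]

theorem tau_conjPi_e_inr (j : Fin n) :
    tau a (conjPi _ (e n (Sum.inr j))) = starRingEnd ℂ (a j) • e n (Sum.inl j) := by
  ext (i | i)
  · by_cases h : i = j
    · subst h; simp [tau_inl, conjPi_apply, e]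
    · simp [tau_inl, conjPi_apply, e, h]
  · simp [tau_inr, conjPi_apply, e]

theorem ι_e_mul_self (r : Fin n ⊕ Fin n) : ι (Q n) (e n r) * ι (Q n) (e n r) = 0 := by
  rw [ι_sq_scalar, Q_apply]
  rcases r with j | j <;> simp [e]

theorem flipVec_mul_e (ha : Unimodular a) (j : Fin n) :
    ι (Q n) (flipVec a j) * ι (Q n) (e n (Sum.inl j))
        = -(ι (Q n) (a j • e n (Sum.inr j)) * ι (Q n) (flipVec a j)) ∧
    ι (Q n) (flipVec a j) * ι (Q n) (e n (Sum.inr j))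
        = -(ι (Q n) (starRingEnd ℂ (a j) • e n (Sum.inl j)) * ι (Q n) (flipVec a j)) := by
  have h1 := ι_e_mul_self (n := n) (Sum.inl j)
  have h2 := ι_e_mul_self (n := n) (Sum.inr j)
  constructor
  · simp only [flipVec, map_sub, map_smul, sub_mul, mul_sub, smul_mul_assoc, mul_smul_comm, h1, h2]
    simp
  · simp only [flipVec, map_sub, map_smul, sub_mul, mul_sub, smul_mul_assoc, mul_smul_comm, h1, h2,
      smul_smul]
    rw [ha j]
    simp

theorem flipProd_mul_ι (ha : Unimodular a) (hn : Even n) (z : W n) :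
    flipProd a (List.finRange n) * ι (Q n) z
      = ι (Q n) (tau a (conjPi _ z)) * flipProd a (List.finRange n) := by
  have h : ∀ r, flipProd a (List.finRange n) * ι (Q n) (e n r)
      = ι (Q n) (tau a (conjPi _ (e n r))) * flipProd a (List.finRange n) := by
    have hlen : (-1 : Cl n) ^ (List.finRange n).length = 1 := by
      rw [List.length_finRange, hn.neg_one_pow]
    rintro (j | j)
    · rw [flipProd_mul_ι_of_mem (List.nodup_finRange n) (List.mem_finRange j) _ _
        (flipVec_mul_e ha j).1, tau_conjPi_e_inl, hlen, one_mul]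
      · intro i hij; rw [b_flipVec]; simp [e, hij]
      · intro i hij; rw [b_flipVec]; simp [e, hij]
    · rw [flipProd_mul_ι_of_mem (List.nodup_finRange n) (List.mem_finRange j) _ _
        (flipVec_mul_e ha j).2, tau_conjPi_e_inr, hlen, one_mul]
      · intro i hij; rw [b_flipVec]; simp [e, hij]
      · intro i hij; rw [b_flipVec]; simp [e, hij]
  have hz : z = ∑ r, z r • e n r := by
    ext r
    simp [e, Finset.sum_apply, Pi.single_apply]
  rw [hz]
  simp only [map_sum, map_smul, map_smulₛₗ, Complex.conj_conj, Finset.mul_sum, Finset.sum_mul,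
    mul_smul_comm, smul_mul_assoc, h]

/-- The conjugate-linear map of `⋀ W₁` that intertwines the action of a vector `z` with the action
of `tau a z`. -/
def intertwiner (a : Fin n → ℂ) :
    ExteriorAlgebra ℂ (W1 n) →ₛₗ[starRingEnd ℂ] ExteriorAlgebra ℂ (W1 n) where
  toFun s := cliffordAction n (flipProd a (List.finRange n)) (conjExterior n s)
  map_add' s t := by rw [map_add, map_add]
  map_smul' c s := by rw [conjExterior_smul, map_smul]

theorem intertwiner_vectorAction (ha : Unimodular a) (hn : Even n) (z : W n)
    (s : ExteriorAlgebra ℂ (W1 n)) :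
    intertwiner a (vectorAction n z s) = vectorAction n (tau a z) (intertwiner a s) := by
  change cliffordAction n _ (conjExterior n _) = _
  rw [conjExterior_vectorAction, ← cliffordAction_ι, ← Module.End.mul_apply, ← map_mul,
    flipProd_mul_ι ha hn, map_mul, cliffordAction_ι, Module.End.mul_apply]
  have : conjPi _ (conjPi _ z) = z := by ext; simp [conjPi_apply]
  rw [this]
  rfl

theorem intertwiner_cliffordAction (ha : Unimodular a) (hn : Even n) (x : Cl n)
    (s : ExteriorAlgebra ℂ (W1 n)) :
    intertwiner a (cliffordAction n x s) = cliffordAction n (theta ha x) (intertwiner a s) := by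
  induction x using CliffordAlgebra.induction generalizing s with
  | algebraMap r =>
    rw [theta_algebraMap, AlgHom.commutes, AlgHom.commutes, Module.algebraMap_end_apply,
      Module.algebraMap_end_apply, map_smulₛₗ]
  | ι v => rw [theta_ι, cliffordAction_ι, cliffordAction_ι, intertwiner_vectorAction ha hn]
  | mul x y hx hy =>
    rw [map_mul, map_mul, map_mul, Module.End.mul_apply, Module.End.mul_apply, hx, hy]
  | add x y hx hy =>
    rw [map_add, map_add, map_add, LinearMap.add_apply, LinearMap.add_apply, map_add, hx, hy]

theorem intertwiner_one : intertwiner a 1 = cliffordAction n (flipProd a (List.finRange n)) 1 := by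
  change cliffordAction n _ (conjExterior n _) = _
  rw [map_one]

theorem flipProd_action_mem {p : ZMod 2} {s : ExteriorAlgebra ℂ (W1 n)} (hs : s ∈ S n p)
    (l : List (Fin n)) : cliffordAction n (flipProd a l) s ∈ S n (p + l.length) := by
  induction l with
  | nil => simpa [flipProd] using hs
  | cons i l ih =>
    rw [flipProd_cons, map_mul, Module.End.mul_apply, cliffordAction_ι, List.length_cons,
      Nat.cast_succ, ← add_assoc]
    exact vectorAction_mem _ ih

theorem theta_flipProd_cons (ha : Unimodular a) (i : Fin n) (l : List (Fin n)) :
    theta ha (flipProd a (i :: l)) = ι (Q n) (tau a (flipVec a i)) * theta ha (flipProd a l) := by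
  rw [flipProd_cons, map_mul, theta_ι]

theorem flipProd_mul_flipProd_one (ha : Unimodular a) (l : List (Fin n)) (hl : l.Nodup) :
    cliffordAction n (theta ha (flipProd a l) * flipProd a l) 1
      = ((-1) ^ (l.length.choose 2) * (l.map a).prod : ℂ) • 1 := by
  have htau : ∀ i, tau a (flipVec a i)
      = a i • e n (Sum.inr i) - (starRingEnd ℂ (a i)) ^ 2 • e n (Sum.inl i) := by
    intro i
    ext (j | j) <;> by_cases h : j = i <;> simp [tau_inl, tau_inr, flipVec, e, h, sq]
  have hcomm : ∀ (l : List (Fin n)) (i : Fin n), i ∉ l →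
      theta ha (flipProd a l) * ι (Q n) (flipVec a i)
        = (-1) ^ l.length * (ι (Q n) (flipVec a i) * theta ha (flipProd a l)) := by
    intro l i
    induction l with
    | nil => simp [flipProd]
    | cons j l ih =>
      intro hi
      rw [List.mem_cons, not_or] at hi
      have hc : ι (Q n) (tau a (flipVec a j)) * (-1) ^ l.length
          = (-1) ^ l.length * ι (Q n) (tau a (flipVec a j)) :=
        ((Commute.neg_one_right _).pow_right _).eq
      have hb : b n (tau a (flipVec a j)) (flipVec a i) = 0 := by
        rw [b_comm, b_flipVec, htau]
        simp [e, hi.1]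
      rw [theta_flipProd_cons, mul_assoc, ih hi.2, List.length_cons, pow_succ, ← mul_assoc, hc,
        mul_assoc, ← mul_assoc (ι (Q n) (tau a (flipVec a j))), ι_mul_ι_of_b_eq_zero hb]
      noncomm_ring
  have hvac : ∀ i, cliffordAction n (ι (Q n) (tau a (flipVec a i)) * ι (Q n) (flipVec a i)) 1
      = a i • 1 := by
    intro i
    have h1 := ι_e_mul_self (n := n) (Sum.inl i)
    have h2 := ι_e_mul_self (n := n) (Sum.inr i)
    have h3 : ι (Q n) (e n (Sum.inr i)) * ι (Q n) (e n (Sum.inl i))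
        = 1 - ι (Q n) (e n (Sum.inl i)) * ι (Q n) (e n (Sum.inr i)) := by
      rw [eq_sub_iff_add_eq, ι_mul_ι_add_swap, polar_Q, b_e_inr]
      simp [e]
    have h4 : cliffordAction n (ι (Q n) (e n (Sum.inr i))) 1 = 0 := by
      rw [cliffordAction_ι, vectorAction_one]
      have : toW1 n (e n (Sum.inr i)) = 0 := by ext j; simp [toW1, LinearMap.funLeft_apply, e]
      rw [this, map_zero]
    rw [htau, flipVec]
    simp only [map_sub, map_smul, sub_mul, mul_sub, smul_mul_assoc, mul_smul_comm, h1, h2, h3]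
    simp [h4]
  induction l with
  | nil => simp [flipProd]
  | cons i l ih =>
    rw [List.nodup_cons] at hl
    have hc := hcomm l i hl.1
    have : theta ha (flipProd a (i :: l)) * flipProd a (i :: l)
        = (-1) ^ l.length • (ι (Q n) (tau a (flipVec a i)) * ι (Q n) (flipVec a i) *
          (theta ha (flipProd a l) * flipProd a l)) := by
      rw [theta_flipProd_cons, flipProd_cons, mul_assoc, ← mul_assoc (theta ha (flipProd a l)), hc,
        zsmul_eq_mul]
      push_cast
      have hc' : ι (Q n) (tau a (flipVec a i)) * (-1) ^ l.length
          = (-1) ^ l.length * ι (Q n) (tau a (flipVec a i)) :=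
        ((Commute.neg_one_right _).pow_right _).eq
      simp only [← mul_assoc, hc']
    rw [this, map_zsmul, LinearMap.smul_apply, map_mul, Module.End.mul_apply, ih hl.2, map_smul,
      hvac, List.map_cons, List.prod_cons, List.length_cons, Nat.choose_succ_succ' l.length 1,
      Nat.choose_one_right, pow_add, ← Int.cast_smul_eq_zsmul ℂ, smul_smul, smul_smul]
    push_cast
    congr 1
    ring

theorem exists_Q_eq_one (hpos : 0 < n) : ∃ w : W n, Q n w = 1 := by
  refine ⟨e n (Sum.inl ⟨0, hpos⟩) + e n (Sum.inr ⟨0, hpos⟩), ?_⟩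
  rw [Q_apply]
  simp [e, Pi.single_apply]

theorem intertwiner_mem (ha : Unimodular a) (hn : Even n) (hpos : 0 < n) {p : ZMod 2}
    {s : ExteriorAlgebra ℂ (W1 n)} (hs : s ∈ S n p) : intertwiner a s ∈ S n p := by
  have h0 : ∀ t ∈ S n 0, intertwiner a t ∈ S n 0 := by
    intro t ht
    refine S_zero_induction (P := fun t => intertwiner a t ∈ S n 0) (fun c => ?_)
      (fun x y hx hy => ?_) (fun u v x hx => ?_) ht
    · rw [map_smulₛₗ, intertwiner_one]
      refine Submodule.smul_mem _ _ ?_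
      have h := flipProd_action_mem (a := a) one_mem_S (List.finRange n)
      rwa [List.length_finRange, (ZMod.natCast_eq_zero_iff_even).2 hn, add_zero] at h
    · rw [map_add]; exact add_mem hx hy
    · rw [intertwiner_vectorAction ha hn, intertwiner_vectorAction ha hn]
      exact vectorAction_mem (p := 1) _ (vectorAction_mem (p := 0) _ hx)
  have hp : ∀ q : ZMod 2, q = 0 ∨ q = 1 := by decide
  rcases hp p with rfl | rfl
  · exact h0 s hs
  · obtain ⟨w, hw⟩ := exists_Q_eq_one hpos
    have h1 := h0 _ (vectorAction_mem (p := 1) w hs)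
    rw [intertwiner_vectorAction ha hn] at h1
    have h2 := vectorAction_mem (p := 0) (tau a w) h1
    rwa [vectorAction_vectorAction_self, Q_tau ha, hw, map_one, one_smul] at h2

/-- The square of the intertwiner is a scalar on the even part and on the odd part. -/
theorem intertwiner_intertwiner (ha : Unimodular a) (hn : Even n) {δ : ℝ}
    (hδ : ∀ i, a i ^ 2 = δ) (hδ2 : δ ^ 2 = 1) {s : ExteriorAlgebra ℂ (W1 n)} (hs : s ∈ S n 0) :
    intertwiner a (intertwiner a s) = ((-1) ^ (n.choose 2) * ∏ i, a i) • s := by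
  refine S_zero_induction (P := fun s => intertwiner a (intertwiner a s) =
    ((-1) ^ (n.choose 2) * ∏ i, a i) • s) (fun c => ?_) (fun x y hx hy => ?_)
    (fun u v x hx => ?_) hs
  · rw [map_smulₛₗ, map_smulₛₗ, intertwiner_one, intertwiner_cliffordAction ha hn,
      intertwiner_one, ← Module.End.mul_apply, ← map_mul,
      flipProd_mul_flipProd_one ha _ (List.nodup_finRange n), List.length_finRange,
      Complex.conj_conj, smul_comm, ← List.ofFn_eq_map, List.prod_ofFn]
  · rw [map_add, map_add, hx, hy, smul_add]
  · rw [intertwiner_vectorAction ha hn, intertwiner_vectorAction ha hn,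
      intertwiner_vectorAction ha hn, intertwiner_vectorAction ha hn, hx, tau_tau hδ, tau_tau hδ]
    simp only [map_smul, LinearMap.smul_apply, smul_smul]
    have : (δ : ℂ) * δ = 1 := by rw [← sq]; exact_mod_cast hδ2
    rw [mul_assoc, this, mul_one]

theorem intertwiner_intertwiner_odd (ha : Unimodular a) (hn : Even n) (hpos : 0 < n) {δ : ℝ}
    (hδ : ∀ i, a i ^ 2 = δ) (hδ2 : δ ^ 2 = 1) {s : ExteriorAlgebra ℂ (W1 n)} (hs : s ∈ S n 1) :
    intertwiner a (intertwiner a s) = (δ * ((-1) ^ (n.choose 2) * ∏ i, a i)) • s := by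
  obtain ⟨w, hw⟩ := exists_Q_eq_one hpos
  have h1 := intertwiner_intertwiner ha hn hδ hδ2 (vectorAction_mem (p := 1) w hs)
  have h2 : s = vectorAction n w (vectorAction n w s) := by
    rw [vectorAction_vectorAction_self, hw, one_smul]
  conv_lhs => rw [h2]
  rw [intertwiner_vectorAction ha hn, intertwiner_vectorAction ha hn, h1, tau_tau hδ]
  simp only [map_smul, LinearMap.smul_apply, smul_smul]
  rw [← h2, mul_comm]

end Flip

/-! ### Irreducibility of the half spin modules under products of two vectors -/

section Schur

variable {n : ℕ}

theorem exists_smul_one_of_vectorAction_inr {s : ExteriorAlgebra ℂ (W1 n)}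
    (hs : ∀ i, vectorAction n (e n (Sum.inr i)) s = 0) : ∃ c : ℂ, s = c • 1 := by
  obtain ⟨c, hc⟩ := exists_algebraMap_of_contractLeft_eq_zero (x := s) fun d => by
    have hd : d = ∑ i, d (Pi.single i 1) • toDual n (e n (Sum.inr i)) := by
      refine LinearMap.pi_ext' fun r => LinearMap.ext_ring ?_
      simp [toDual_apply, e, Pi.single_apply]
    rw [hd, map_sum, LinearMap.sum_apply]
    refine Finset.sum_eq_zero fun i _ => ?_
    have h := hs i
    rw [vectorAction_apply] at h
    have h0 : toW1 n (e n (Sum.inr i)) = 0 := by ext j; simp [toW1, LinearMap.funLeft_apply, e]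
    rw [h0, map_zero, zero_mul, zero_add] at h
    rw [map_smul, LinearMap.smul_apply]
    erw [h]
    rw [smul_zero]
  exact ⟨c, by rw [hc, Algebra.algebraMap_eq_smul_one]⟩

theorem vectorAction_inr_one (i : Fin n) : vectorAction n (e n (Sum.inr i)) 1 = 0 := by
  rw [vectorAction_one]
  have : toW1 n (e n (Sum.inr i)) = 0 := by ext j; simp [toW1, LinearMap.funLeft_apply, e]
  rw [this, map_zero]

/-- A linear map that commutes with all products of two vectors on the even part of `⋀ W₁` is a
scalar there. -/
theorem schur_zero {A : Module.End ℂ (ExteriorAlgebra ℂ (W1 n))}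
    (hA : ∀ u v, ∀ s ∈ S n 0, A (vectorAction n u (vectorAction n v s))
      = vectorAction n u (vectorAction n v (A s))) : ∃ c : ℂ, ∀ s ∈ S n 0, A s = c • s := by
  have h1 : ∀ u i, vectorAction n u (vectorAction n (e n (Sum.inr i)) (A 1)) = 0 := fun u i => by
    rw [← hA _ _ _ one_mem_S, vectorAction_inr_one, map_zero, map_zero]
  have h2 : ∀ i, vectorAction n (e n (Sum.inr i)) (A 1) = 0 := fun i => by
    have h := vectorAction_add_swap (e n (Sum.inl i)) (e n (Sum.inr i))
      (vectorAction n (e n (Sum.inr i)) (A 1))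
    rw [h1, h1, map_zero, b_e_inl] at h
    simpa [e] using h.symm
  obtain ⟨c, hc⟩ := exists_smul_one_of_vectorAction_inr h2
  refine ⟨c, fun s hs => And.right (a := s ∈ S n 0) ?_⟩
  refine S_zero_induction (P := fun s => s ∈ S n 0 ∧ A s = c • s)
    (fun d => ⟨Submodule.smul_mem _ _ one_mem_S, ?_⟩)
    (fun x y hx hy => ⟨add_mem hx.1 hy.1, ?_⟩) (fun u v x hx => ⟨?_, ?_⟩) hs
  · rw [map_smul, hc, smul_comm]
  · rw [map_add, hx.2, hy.2, smul_add]
  · exact vectorAction_mem (p := 1) _ (vectorAction_mem (p := 0) _ hx.1)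
  · rw [hA _ _ _ hx.1, hx.2, map_smul, map_smul]

theorem schur (hpos : 0 < n) {p : ZMod 2} {A : Module.End ℂ (ExteriorAlgebra ℂ (W1 n))}
    (hA : ∀ u v, ∀ s ∈ S n p, A (vectorAction n u (vectorAction n v s))
      = vectorAction n u (vectorAction n v (A s))) : ∃ c : ℂ, ∀ s ∈ S n p, A s = c • s := by
  have hp : ∀ q : ZMod 2, q = 0 ∨ q = 1 := by decide
  rcases hp p with rfl | rfl
  · exact schur_zero hA
  · obtain ⟨w, hw⟩ := exists_Q_eq_one hpos
    have hww : ∀ s, vectorAction n w (vectorAction n w s) = s := fun s => by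
      rw [vectorAction_vectorAction_self, hw, one_smul]
    obtain ⟨c, hc⟩ := schur_zero (A := vectorAction n w * A * vectorAction n w) fun u v s hs => by
      have hs1 := vectorAction_mem (p := 0) w hs
      have h := hA w u _ (vectorAction_mem (p := 0) v hs)
      have h' := hA v w _ hs1
      rw [hww] at h'
      simp only [Module.End.mul_apply]
      rw [h, h', hww]
    refine ⟨c, fun s hs => ?_⟩
    have h := hc _ (vectorAction_mem (p := 1) w hs)
    simp only [Module.End.mul_apply, hww] at h
    rw [← hww (A s), h, map_smul, hww]

end Schur

/-! ### The spin cover is fixed by the real structure -/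

section Fixed

variable {n : ℕ} {a : Fin n → ℂ}

theorem tau_surjective {δ : ℝ} (hδ : ∀ i, a i ^ 2 = δ) (hδ2 : δ ^ 2 = 1) :
    Function.Surjective (tau a) := fun z => by
  refine ⟨(δ : ℂ) • tau a z, ?_⟩
  have : (δ : ℂ) * δ = 1 := by rw [← sq]; exact_mod_cast hδ2
  rw [map_smulₛₗ, tau_tau hδ, Complex.conj_ofReal, smul_smul, this, one_smul]

theorem theta_eq_self_or_neg (ha : Unimodular a) {δ : ℝ} (hδ : ∀ i, a i ^ 2 = δ)
    (hδ2 : δ ^ 2 = 1) {x : Spin n} (hx : ∀ w, rho n x (tau a w) = tau a (rho n x w)) :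
    theta ha x = x ∨ theta ha x = -x := by
  have hxs : star (x : Cl n) * x = 1 := spinGroup.coe_star_mul_self x
  have hsx : (x : Cl n) * star (x : Cl n) = 1 := spinGroup.coe_mul_star_self x
  have hts : star (theta ha x) * theta ha x = 1 := by
    rw [← theta_star, ← map_mul, hxs, map_one]
  have hev : (x : Cl n) ∈ even (Q n) := spinGroup.mem_even x.2
  have hsev : star (x : Cl n) ∈ even (Q n) := spinGroup.mem_even (spinGroup.star_mem x.2)
  obtain ⟨c, hc⟩ := exists_algebraMap_of_commute (x := star (x : Cl n) * theta ha x)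
    (mul_mem hsev (theta_mem_even ha hev)) fun w => by
      obtain ⟨z, rfl⟩ := tau_surjective hδ hδ2 w
      have h1 : (x : Cl n) * ι (Q n) (tau a z) * star (x : Cl n)
          = theta ha x * ι (Q n) (tau a z) * star (theta ha x) := by
        rw [← iota_rhoLin, ← theta_ι ha, ← theta_star, ← map_mul, ← map_mul, ← iota_rhoLin,
          theta_ι]
        exact congrArg _ (hx z)
      calc ι (Q n) (tau a z) * (star (x : Cl n) * theta ha x)
          = (star (x : Cl n) * x) * ι (Q n) (tau a z) * star (x : Cl n) * theta ha x := by
            rw [hxs, one_mul, mul_assoc]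
        _ = star (x : Cl n) * (x * ι (Q n) (tau a z) * star (x : Cl n)) * theta ha x := by
            simp only [mul_assoc]
        _ = star (x : Cl n) * theta ha x * ι (Q n) (tau a z) *
            (star (theta ha x) * theta ha x) := by
            rw [h1]; simp only [mul_assoc]
        _ = _ := by rw [hts, mul_one]
  have h2 : theta ha x = c • (x : Cl n) := by
    rw [Algebra.smul_def, Algebra.commutes, ← hc, ← mul_assoc, hsx, one_mul]
  have h3 : algebraMap ℂ (Cl n) (c ^ 2) = algebraMap ℂ (Cl n) 1 := by
    rw [h2, CliffordAlgebra.star_smul, smul_mul_smul_comm, hxs] at hts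
    rw [map_one, Algebra.algebraMap_eq_smul_one, sq, hts]
  have h4 : c ^ 2 = 1 := (algebraMap ℂ (Cl n)).injective h3
  rcases sq_eq_one_iff.1 h4 with rfl | rfl
  · left; rw [h2, one_smul]
  · right; rw [h2, neg_smul, one_smul]

theorem continuous_dual_theta (ha : Unimodular a) (φ : Module.Dual ℂ (Cl n)) :
    Continuous fun x => φ (theta ha x) := by
  let f : Cl n →ₛₗ[starRingEnd ℂ] ℂ :=
    { toFun := fun x => φ (theta ha x)
      map_add' := fun x y => by rw [map_add, map_add]
      map_smul' := fun c x => by rw [theta_smul, map_smul] }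
  exact IsModuleTopology.continuous_of_linearMapₛₗ (σ := starRingEnd ℂ) Complex.continuous_conj f

theorem theta_eq_of_mem_spinCover (ha : Unimodular a) {δ : ℝ} (hδ : ∀ i, a i ^ 2 = δ)
    (hδ2 : δ ^ 2 = 1) {H : Subgroup (LinearMap.GeneralLinearGroup ℂ (W n))}
    (hH : ∀ x ∈ preimage H, ∀ w, rho n x (tau a w) = tau a (rho n x w))
    {x : Spin n} (hx : x ∈ spinCover H) : theta ha x = x := by
  have hclosed : ∀ c : ℂ, IsClosed {y : Cl n | theta ha y = c • y} := fun c => by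
    have : {y : Cl n | theta ha y = c • y}
        = ⋂ φ : Module.Dual ℂ (Cl n), {y | φ (theta ha y) = φ (c • y)} := by
      ext y
      simp only [Set.mem_iInter, Set.mem_ofPred_eq]
      exact ⟨fun h φ => by rw [h], fun h => sub_eq_zero.1
        ((Module.forall_dual_apply_eq_zero_iff ℂ _).1 fun φ => by rw [map_sub, h, sub_self])⟩
    rw [this]
    refine isClosed_iInter fun φ => isClosed_eq (continuous_dual_theta ha φ) ?_
    exact IsModuleTopology.continuous_of_linearMap (φ ∘ₗ (c • LinearMap.id))
  have hcover : connectedComponentIn (preimageSet H) 1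
      ⊆ {y : Cl n | theta ha y = (1 : ℂ) • y} ∪ {y : Cl n | theta ha y = (-1 : ℂ) • y} := by
    intro y hy
    obtain ⟨z, hz, rfl⟩ := connectedComponentIn_subset _ _ hy
    rcases theta_eq_self_or_neg ha hδ hδ2 (hH z hz) with h | h
    · left; simpa using h
    · right; simpa using h
  have hx' : (x : Cl n) ∈ connectedComponentIn (preimageSet H) 1 := hx
  rcases hcover hx' with h | h
  · simpa using h
  · exfalso
    have h1 : (1 : Cl n) ∈ connectedComponentIn (preimageSet H) 1 :=
      mem_connectedComponentIn ⟨1, one_mem _, rfl⟩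
    obtain ⟨y, hy, hy1, hy2⟩ := isPreconnected_closed_iff.1
      (isPreconnected_connectedComponentIn (F := preimageSet H) (x := 1)) _ _
      (hclosed 1) (hclosed (-1)) hcover ⟨1, h1, by simp⟩ ⟨x, hx', h⟩
    obtain ⟨z, hz, rfl⟩ := connectedComponentIn_subset _ _ hy
    have h5 : (2 : ℂ) • (z : Cl n) = 0 := by
      have h6 : (1 : ℂ) • (z : Cl n) = (-1 : ℂ) • (z : Cl n) := hy1.symm.trans hy2
      rw [show (2 : ℂ) = 1 - (-1) by norm_num, sub_smul, h6, sub_self]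
    have h7 : (z : Cl n) = 0 := (smul_eq_zero.1 h5).resolve_left two_ne_zero
    have h8 := spinGroup.coe_star_mul_self z
    rw [h7, mul_zero] at h8
    exact zero_ne_one h8

/-! ### One-parameter families in the spin cover -/

theorem ι_mul_ι_mem_spinGroup {u w : W n} (h : Q n u * Q n w = 1) :
    ι (Q n) u * ι (Q n) w ∈ spinGroup (Q n) := by
  have hstar : star (ι (Q n) u * ι (Q n) w) = ι (Q n) w * ι (Q n) u := by
    rw [star_mul, star_ι, star_ι, neg_mul_neg]
  have hmul : ∀ u w : W n, Q n u * Q n w = 1 →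
      ι (Q n) u * ι (Q n) w * (ι (Q n) w * ι (Q n) u) = 1 := fun u w h => by
    rw [mul_assoc, ← mul_assoc (ι (Q n) w), ι_sq_scalar, Algebra.commutes, ← mul_assoc,
      ι_sq_scalar, ← map_mul, h, map_one]
  have hu : IsUnit (ι (Q n) u) := isUnit_ι_of_isUnit (Q := Q n) (IsUnit.of_mul_eq_one _ h)
  have hw : IsUnit (ι (Q n) w) :=
    isUnit_ι_of_isUnit (Q := Q n) (IsUnit.of_mul_eq_one _ (by rwa [mul_comm] at h))
  refine spinGroup.mem_iff.2 ⟨pinGroup.mem_iff.2 ⟨⟨hu.unit * hw.unit, ?_, ?_⟩, ?_⟩,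
    ι_mul_ι_mem_evenOdd_zero (Q n) _ _⟩
  · exact mul_mem (Subgroup.subset_closure ⟨u, hu.unit_spec.symm⟩)
      (Subgroup.subset_closure ⟨w, hw.unit_spec.symm⟩)
  · simp
  · rw [Unitary.mem_iff, hstar]
    exact ⟨hmul w u (by rwa [mul_comm]), hmul u w h⟩

theorem rho_tau_of_theta_eq (ha : Unimodular a) {x : Spin n} (hx : theta ha x = x) (w : W n) :
    rho n x (tau a w) = tau a (rho n x w) := by
  apply iota_injective n
  change ι (Q n) (rhoLin x _) = ι (Q n) (tau a (rhoLin x w))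
  rw [iota_rhoLin, ← theta_ι ha, ← theta_ι ha, iota_rhoLin, map_mul, map_mul, theta_star, hx]

/-- Data of an infinitesimal generator `X` of a one-parameter family in the spin group fixed by the
real structure. -/
theorem exists_generator (ha : Unimodular a) {δ : ℝ} (hδ : ∀ i, a i ^ 2 = δ)
    (hδ2 : δ ^ 2 = 1) (u : W n) :
    ∃ (κ μ : ℂ) (q : ℝ), κ ≠ 0 ∧
      ∀ X, X = κ • (ι (Q n) u * ι (Q n) (tau a u)) - algebraMap ℂ _ μ →
      theta ha X = X ∧ X * X = algebraMap ℂ _ (q : ℂ) ∧ star X = -X := by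
  obtain ⟨κ, hκ0, hκ⟩ : ∃ κ : ℂ, κ ≠ 0 ∧ starRingEnd ℂ κ * δ = -κ := by
    rcases sq_eq_one_iff.1 hδ2 with rfl | rfl
    · exact ⟨Complex.I, Complex.I_ne_zero, by simp⟩
    · exact ⟨1, one_ne_zero, by simp⟩
  have hδδ : (δ : ℂ) * δ = 1 := by rw [← sq]; exact_mod_cast hδ2
  set β := b n u (tau a u) with hβ
  have hcβ : starRingEnd ℂ β = δ * β := by
    rw [hβ, ← b_tau ha, tau_tau hδ, b_comm]
    simp only [b, Pi.smul_apply, smul_eq_mul, Finset.mul_sum]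
    exact Finset.sum_congr rfl fun i _ => by ring
  set p := ι (Q n) u * ι (Q n) (tau a u) with hp
  have hswap : ι (Q n) (tau a u) * ι (Q n) u = algebraMap ℂ _ β - p := by
    rw [eq_sub_iff_add_eq, hp, ι_mul_ι_add_swap, polar_Q, b_comm]
  have htp : theta ha p = (δ : ℂ) • (algebraMap ℂ _ β - p) := by
    rw [hp, map_mul, theta_ι, theta_ι, tau_tau hδ, map_smul, mul_smul_comm, hswap]
  have hsp : star p = algebraMap ℂ _ β - p := by
    rw [← hswap, hp, star_mul, star_ι, star_ι, neg_mul_neg]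
  have hpp : p * p = β • p - algebraMap ℂ _ (Q n u * starRingEnd ℂ (Q n u)) := by
    have : p * (algebraMap ℂ _ β - p) = algebraMap ℂ _ (Q n u * starRingEnd ℂ (Q n u)) := by
      rw [← hswap, hp, mul_assoc, ← mul_assoc (ι (Q n) (tau a u)), ι_sq_scalar, Algebra.commutes,
        ← mul_assoc, ι_sq_scalar, ← map_mul, Q_tau ha]
    rw [← this, mul_sub, ← Algebra.commutes, ← Algebra.smul_def]
    abel
  obtain ⟨q, hq⟩ : ∃ q : ℝ, (q : ℂ) = κ ^ 2 * (β ^ 2 / 4 - Q n u * starRingEnd ℂ (Q n u)) := by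
    refine ⟨(κ ^ 2 * (β ^ 2 / 4 - Q n u * starRingEnd ℂ (Q n u))).re, ?_⟩
    apply Complex.conj_eq_iff_re.1
    have hκ2 : starRingEnd ℂ κ = - (κ * δ) := by linear_combination δ * hκ - starRingEnd ℂ κ * hδδ
    simp only [map_mul, map_pow, map_sub, map_div₀, Complex.conj_conj, hcβ, hκ2]
    have h4 : starRingEnd ℂ (4 : ℂ) = 4 := Complex.conj_ofNat 4
    rw [h4]
    linear_combination (κ ^ 2 * β ^ 2 / 4 * (δ * δ + 1)
      - κ ^ 2 * Q n u * starRingEnd ℂ (Q n u)) * hδδ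
  refine ⟨κ, κ * β / 2, q, hκ0, ?_⟩
  rintro X rfl
  simp only [Algebra.algebraMap_eq_smul_one] at *
  refine ⟨?_, ?_, ?_⟩
  · rw [map_sub, theta_smul, theta_smul, htp, map_one, smul_smul, hκ, map_div₀, map_mul, hcβ]
    have h2 : starRingEnd ℂ (2 : ℂ) = 2 := Complex.conj_ofNat 2
    rw [h2, show starRingEnd ℂ κ * (δ * β) / 2 = -κ * β / 2 by rw [← hκ]; ring]
    module
  · rw [hq, sub_mul, mul_sub, mul_sub, smul_mul_smul_comm, hpp, smul_mul_smul_comm,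
      smul_mul_smul_comm, smul_mul_smul_comm]
    simp only [one_mul, mul_one]
    module
  · rw [star_sub, CliffordAlgebra.star_smul, CliffordAlgebra.star_smul, hsp, star_one]
    module

end Fixed

section OneParameter

variable {n : ℕ} {a : Fin n → ℂ}

/-- The one-parameter family `(1 + s X)² / (1 - s² q)`. -/
def cayley (q : ℝ) (X : Cl n) (s : ℝ) : Cl n :=
  (((1 + s ^ 2 * q) / (1 - s ^ 2 * q) : ℝ) : ℂ) • (1 : Cl n)
    + ((2 * s / (1 - s ^ 2 * q) : ℝ) : ℂ) • X

theorem cayley_mem_preimageSet (ha : Unimodular a)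
    {H : Subgroup (LinearMap.GeneralLinearGroup ℂ (W n))}
    (hH : ∀ h : Spin n, (∀ w, rho n h (tau a w) = tau a (rho n h w)) → h * h ∈ preimage H)
    {q : ℝ} {X : Cl n} (hX1 : theta ha X = X) (hX2 : X * X = (q : ℂ) • 1) (hX3 : star X = -X)
    {u : W n} (hu : ∀ s : ℂ, ∃ w, 1 + s • X = ι (Q n) u * ι (Q n) w)
    {s : ℝ} (hs : 0 < 1 - s ^ 2 * q) : cayley q X s ∈ preimageSet H := by
  obtain ⟨N, hN⟩ : ∃ N : ℝ, N * N * (1 - s ^ 2 * q) = 1 :=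
    ⟨(√(1 - s ^ 2 * q))⁻¹, by
      rw [← mul_inv, Real.mul_self_sqrt hs.le, inv_mul_cancel₀ hs.ne']⟩
  have hN2 : (N : ℂ) * N * (1 - s ^ 2 * q) = 1 := by exact_mod_cast hN
  have hN3 : (N : ℂ) * N = 1 / (1 - s ^ 2 * q) :=
    eq_div_of_mul_eq (right_ne_zero_of_mul_eq_one hN2) hN2
  obtain ⟨w, hw⟩ := hu s
  obtain ⟨h, hh⟩ : ∃ h, h = (N : ℂ) • (1 + (s : ℂ) • X) := ⟨_, rfl⟩
  have hhw : h = ι (Q n) u * ι (Q n) ((N : ℂ) • w) := by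
    rw [map_smul, mul_smul_comm, ← hw, hh]
  have hstar : star h = (N : ℂ) • (1 - (s : ℂ) • X) := by
    rw [hh, CliffordAlgebra.star_smul, star_add, CliffordAlgebra.star_smul, hX3, star_one,
      smul_neg, sub_eq_add_neg]
  have hmul : h * star h = 1 := by
    rw [hstar, hh, smul_mul_smul_comm, add_mul, mul_sub, mul_sub, smul_mul_smul_comm, hX2,
      mul_one, mul_one, one_mul]
    calc _ = ((N : ℂ) * N * (1 - s ^ 2 * q)) • (1 : Cl n) := by module
      _ = 1 := by rw [hN2, one_smul]
  have hQ : Q n u * Q n ((N : ℂ) • w) = 1 := by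
    have h1 : algebraMap ℂ (Cl n) (Q n u * Q n ((N : ℂ) • w)) = 1 := by
      rw [← hmul, hhw]
      generalize (N : ℂ) • w = v
      rw [star_mul, star_ι, star_ι, neg_mul_neg, mul_assoc, ← mul_assoc (ι (Q n) v),
        ι_sq_scalar, Algebra.commutes, ← mul_assoc, ι_sq_scalar, map_mul]
    exact (algebraMap ℂ (Cl n)).injective (h1.trans (map_one _).symm)
  have hmem : h ∈ spinGroup (Q n) := by
    rw [hhw]
    exact ι_mul_ι_mem_spinGroup hQ
  have hθ : theta ha h = h := by
    rw [hh, theta_smul, map_add, theta_smul, map_one, hX1, Complex.conj_ofReal,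
      Complex.conj_ofReal]
  obtain ⟨x, hx⟩ : ∃ x : Spin n, (x : Cl n) = h := ⟨⟨h, hmem⟩, rfl⟩
  rw [← hx] at hθ
  refine ⟨x * x, hH x (rho_tau_of_theta_eq ha hθ), ?_⟩
  simp only [Submonoid.coe_mul]
  rw [hx, cayley, hh, smul_mul_smul_comm, add_mul, mul_add, mul_add, smul_mul_smul_comm, hX2,
      mul_one, mul_one, one_mul, hN3]
  push_cast
  module

/-- The spin cover contains elements whose span with `1` contains the product of `u` and
`tau a u`. -/
theorem exists_mem_spinCover (ha : Unimodular a) {δ : ℝ} (hδ : ∀ i, a i ^ 2 = δ)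
    (hδ2 : δ ^ 2 = 1) {H : Subgroup (LinearMap.GeneralLinearGroup ℂ (W n))}
    (hH : ∀ h : Spin n, (∀ w, rho n h (tau a w) = tau a (rho n h w)) → h * h ∈ preimage H)
    {u : W n} (hu : Q n u ≠ 0) :
    ∃ g ∈ spinCover H, ∃ r d : ℂ, r ≠ 0 ∧
      (g : Cl n) = r • (ι (Q n) u * ι (Q n) (tau a u)) + algebraMap ℂ _ d := by
  obtain ⟨κ, μ, q, hκ, hX⟩ := exists_generator ha hδ hδ2 u
  obtain ⟨X, hXdef⟩ : ∃ X, X = κ • (ι (Q n) u * ι (Q n) (tau a u)) - algebraMap ℂ _ μ := ⟨_, rfl⟩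
  obtain ⟨hX1, hX2, hX3⟩ := hX X hXdef
  rw [Algebra.algebraMap_eq_smul_one] at hX2
  have hfactor : ∀ s : ℂ, ∃ w, 1 + s • X = ι (Q n) u * ι (Q n) w := fun s => by
    refine ⟨((1 - s * μ) / Q n u) • u + (s * κ) • tau a u, ?_⟩
    rw [map_add, map_smul, map_smul, mul_add, mul_smul_comm,
      mul_smul_comm, ι_sq_scalar, Algebra.algebraMap_eq_smul_one, smul_smul,
      div_mul_cancel₀ _ hu, hXdef, Algebra.algebraMap_eq_smul_one]
    module
  have hγ : ∀ s : ℝ, 0 < 1 - s ^ 2 * q → cayley q X s ∈ preimageSet H := fun s hs =>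
    cayley_mem_preimageSet ha hH hX1 hX2 hX3 hfactor hs
  set t : ℝ := (1 + |q|)⁻¹ with ht
  have hq0 := abs_nonneg q
  have ht0 : 0 < t := by positivity
  have htq : t * (1 + |q|) = 1 := inv_mul_cancel₀ (by positivity)
  have hpos : ∀ s ∈ Set.Icc 0 t, 0 < 1 - s ^ 2 * q := by
    intro s hs
    have h1 : s ^ 2 * q ≤ t ^ 2 * |q| :=
      (mul_le_mul_of_nonneg_left (le_abs_self q) (sq_nonneg s)).trans
        (mul_le_mul_of_nonneg_right (pow_le_pow_left₀ hs.1 hs.2 2) hq0)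
    have h2 : t ^ 2 * |q| = t * (1 - t) := by rw [← htq]; ring
    nlinarith [sq_nonneg t]
  have hcont : ContinuousOn (cayley q X) (Set.Icc 0 t) := by
    have : ContinuousAdd (Cl n) := IsModuleTopology.toContinuousAdd ℂ (Cl n)
    have : ContinuousSMul ℂ (Cl n) := IsModuleTopology.toContinuousSMul ℂ (Cl n)
    have hne : ∀ s ∈ Set.Icc 0 t, 1 - s ^ 2 * q ≠ 0 := fun s hs => (hpos s hs).ne'
    have h1 : ContinuousOn (fun s : ℝ => (((1 + s ^ 2 * q) / (1 - s ^ 2 * q) : ℝ) : ℂ))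
        (Set.Icc 0 t) := Complex.continuous_ofReal.comp_continuousOn
      (ContinuousOn.div (by fun_prop) (by fun_prop) hne)
    have h2 : ContinuousOn (fun s : ℝ => ((2 * s / (1 - s ^ 2 * q) : ℝ) : ℂ))
        (Set.Icc 0 t) := Complex.continuous_ofReal.comp_continuousOn
      (ContinuousOn.div (by fun_prop) (by fun_prop) hne)
    exact (h1.smul (continuousOn_const (c := (1 : Cl n)))).add
      (h2.smul (continuousOn_const (c := X)))
  have hγ0 : cayley q X 0 = 1 := by simp [cayley]
  have hpre := (isPreconnected_Icc (a := (0 : ℝ)) (b := t)).image (cayley q X) hcont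
  have hsub := hpre.subset_connectedComponentIn
    (F := preimageSet H) (x := 1) ⟨0, ⟨le_rfl, ht0.le⟩, hγ0⟩ (by
      rintro _ ⟨s, hs, rfl⟩
      exact hγ s (hpos s hs))
  have hmem : cayley q X t ∈ connectedComponentIn (preimageSet H) 1 :=
    hsub ⟨t, ⟨ht0.le, le_rfl⟩, rfl⟩
  obtain ⟨g, hg, hgt⟩ := connectedComponentIn_subset _ _ hmem
  have hgt' : (g : Cl n) = cayley q X t := hgt
  have htN := hpos t ⟨ht0.le, le_rfl⟩
  refine ⟨g, show (g : Cl n) ∈ connectedComponentIn (preimageSet H) 1 by rwa [hgt'],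
    ((2 * t / (1 - t ^ 2 * q) : ℝ) : ℂ) * κ,
    (((1 + t ^ 2 * q) / (1 - t ^ 2 * q) : ℝ) : ℂ) - ((2 * t / (1 - t ^ 2 * q) : ℝ) : ℂ) * μ,
    mul_ne_zero ?_ hκ, ?_⟩
  · rw [Complex.ofReal_ne_zero]
    positivity
  · rw [hgt']
    simp only [cayley, hXdef, Algebra.algebraMap_eq_smul_one]
    module

end OneParameter

/-! ### Spanning by the real basis -/

section RealBasis

variable {n : ℕ}

theorem e_inl_eq (k : ℕ) (i : Fin n) : ∃ x y : ℂ, e n (Sum.inl i) =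
    x • realBasis n k (Sum.inl i) + y • realBasis n k (Sum.inr i) := by
  have hI := Complex.I_mul_I
  by_cases h : i.val < k
  · refine ⟨-Complex.I / 2, 1 / 2, ?_⟩
    simp only [realBasis, h, if_true, smul_smul, smul_add, smul_sub]
    rw [show -Complex.I / 2 * Complex.I = 1 / 2 by linear_combination -hI / 2]
    module
  · refine ⟨1 / 2, -Complex.I / 2, ?_⟩
    simp only [realBasis, h, if_false, smul_smul, smul_add, smul_sub]
    rw [show -Complex.I / 2 * Complex.I = 1 / 2 by linear_combination -hI / 2]
    module

theorem e_inr_eq (k : ℕ) (i : Fin n) : ∃ x y : ℂ, e n (Sum.inr i) =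
    x • realBasis n k (Sum.inl i) + y • realBasis n k (Sum.inr i) := by
  have hI := Complex.I_mul_I
  by_cases h : i.val < k
  · refine ⟨-Complex.I / 2, -1 / 2, ?_⟩
    simp only [realBasis, h, if_true, smul_smul, smul_add, smul_sub]
    rw [show -Complex.I / 2 * Complex.I = 1 / 2 by linear_combination -hI / 2]
    module
  · refine ⟨1 / 2, Complex.I / 2, ?_⟩
    simp only [realBasis, h, if_false, smul_smul, smul_add, smul_sub]
    rw [show Complex.I / 2 * Complex.I = -1 / 2 by linear_combination hI / 2]
    module

theorem eq_sum_e (z : W n) : z = ∑ r, z r • e n r := by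
  ext r
  simp [e, Finset.sum_apply, Pi.single_apply]

/-- A property closed under linear combinations that holds on the real basis holds on `W`. -/
theorem realBasis_induction (k : ℕ) {P : W n → Prop} (add : ∀ x y, P x → P y → P (x + y))
    (smul : ∀ (c : ℂ) x, P x → P (c • x)) (basis : ∀ r, P (realBasis n k r)) (zero : P 0)
    (z : W n) : P z := by
  rw [eq_sum_e z]
  refine Finset.sum_induction _ P add zero fun r _ => smul _ _ ?_
  rcases r with i | i
  · obtain ⟨x, y, h⟩ := e_inl_eq k i
    rw [h]; exact add _ _ (smul _ _ (basis _)) (smul _ _ (basis _))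
  · obtain ⟨x, y, h⟩ := e_inr_eq k i
    rw [h]; exact add _ _ (smul _ _ (basis _)) (smul _ _ (basis _))

theorem Q_add (z w : W n) : Q n (z + w) = Q n z + Q n w + b n z w := by
  rw [← polar_Q, QuadraticMap.polar]; ring

theorem Q_eq_b (z : W n) : Q n z = b n z z / 2 := by
  rw [b, Q_apply, Finset.sum_div]
  exact Finset.sum_congr rfl fun i _ => by ring

end RealBasis

section Irreducible

variable {n : ℕ} {a : Fin n → ℂ}

/-- A linear map that commutes with the spin cover on a half spin module is a scalar there. -/
theorem schur_spinCover (ha : Unimodular a) {δ : ℝ} (hδ : ∀ i, a i ^ 2 = δ)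
    (hδ2 : δ ^ 2 = 1) {H : Subgroup (LinearMap.GeneralLinearGroup ℂ (W n))}
    (hH : ∀ h : Spin n, (∀ w, rho n h (tau a w) = tau a (rho n h w)) → h * h ∈ preimage H)
    (hpos : 0 < n) {p : ZMod 2} {A : Module.End ℂ (ExteriorAlgebra ℂ (W1 n))}
    (hA : ∀ g ∈ spinCover H, ∀ s ∈ S n p,
      A (cliffordAction n (g : Cl n) s) = cliffordAction n (g : Cl n) (A s)) :
    ∃ c : ℂ, ∀ s ∈ S n p, A s = c • s := by
  let D : W n → W n → ExteriorAlgebra ℂ (W1 n) → ExteriorAlgebra ℂ (W1 n) := fun u v s =>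
    A (vectorAction n u (vectorAction n (tau a v) s))
      - vectorAction n u (vectorAction n (tau a v) (A s))
  have hD_add_left : ∀ u u' v s, D (u + u') v s = D u v s + D u' v s := fun u u' v s => by
    simp only [D, map_add, LinearMap.add_apply]; abel
  have hD_add_right : ∀ u v v' s, D u (v + v') s = D u v s + D u v' s := fun u v v' s => by
    simp only [D, map_add, LinearMap.add_apply]; abel
  have hD_smul_left : ∀ c u v s, D (c • u) v s = c • D u v s := fun (c : ℂ) u v s => by
    simp only [D, map_smul, LinearMap.smul_apply, smul_sub]
  have hD_smul_right : ∀ c u v s, D u (c • v) s = starRingEnd ℂ c • D u v s :=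
      fun (c : ℂ) u v s => by
    simp only [D, map_smulₛₗ, LinearMap.smul_apply, smul_sub, RingHom.id_apply]
  have hdiag : ∀ u, Q n u ≠ 0 → ∀ s ∈ S n p, D u u s = 0 := by
    intro u hu s hs
    obtain ⟨g, hg, r, d, hr, hgrd⟩ := exists_mem_spinCover ha hδ hδ2 hH hu
    have h := hA g hg s hs
    rw [hgrd] at h
    simp only [map_add, map_smul, LinearMap.add_apply, LinearMap.smul_apply, AlgHom.commutes,
      Module.algebraMap_end_apply, map_mul, Module.End.mul_apply, cliffordAction_ι,
      add_left_inj] at h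
    exact sub_eq_zero.2 (smul_right_injective _ hr h)
  have hbasis : ∀ r t, ∀ s ∈ S n p, D (realBasis n 0 r) (realBasis n 0 t) s = 0 := by
    intro r t s hs
    have hb := b_realBasis n 0
    have hQ : ∀ r, Q n (realBasis n 0 r) = 1 := fun r => by
      rw [Q_eq_b, hb]
      rcases r with i | i <;> simp [eta]
    rcases eq_or_ne r t with rfl | hrt
    · exact hdiag _ (by rw [hQ]; exact one_ne_zero) s hs
    have hrr := hdiag (realBasis n 0 r) (by rw [hQ]; exact one_ne_zero) s hs
    have htt := hdiag (realBasis n 0 t) (by rw [hQ]; exact one_ne_zero) s hs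
    have hsum : ∀ c : ℂ, 1 + c * c ≠ 0 →
        starRingEnd ℂ c • D (realBasis n 0 r) (realBasis n 0 t) s
          + c • D (realBasis n 0 t) (realBasis n 0 r) s = 0 := by
      intro c hc
      have h := hdiag (realBasis n 0 r + c • realBasis n 0 t) (by
        rw [Q_add, QuadraticMap.map_smul, hQ, hQ]
        have : b n (realBasis n 0 r) (c • realBasis n 0 t)
            = c * b n (realBasis n 0 r) (realBasis n 0 t) := by
          simp only [b, Pi.smul_apply, smul_eq_mul, Finset.mul_sum]
          exact Finset.sum_congr rfl fun i _ => by ring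
        rw [this, hb]
        simpa [eta, hrt] using hc) s hs
      simp only [hD_add_left, hD_add_right, hD_smul_left, hD_smul_right, hrr, htt, smul_zero,
        zero_add, add_zero] at h
      exact h
    have h1 := hsum 1 (by norm_num)
    have h2 := hsum (1 + Complex.I) (by
      intro h
      have := congrArg Complex.re h
      simp at this)
    simp only [map_one, one_smul] at h1
    rw [eq_neg_of_add_eq_zero_right h1] at h2
    simp only [map_add, map_one, Complex.conj_I] at h2
    have h3 : (-2 * Complex.I) • D (realBasis n 0 r) (realBasis n 0 t) s = 0 := by
      rw [← h2]; module
    exact (smul_eq_zero.1 h3).resolve_left (by simp)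
  have hD : ∀ u v, ∀ s ∈ S n p, D u v s = 0 := by
    intro u v s hs
    refine realBasis_induction 0 (P := fun u => D u v s = 0)
      (fun x y hx hy => by rw [hD_add_left, hx, hy, add_zero])
      (fun c x hx => by rw [hD_smul_left, hx, smul_zero]) (fun r => ?_)
      (by simp [D]) u
    refine realBasis_induction 0 (P := fun v => D (realBasis n 0 r) v s = 0)
      (fun x y hx hy => by rw [hD_add_right, hx, hy, add_zero])
      (fun c x hx => by rw [hD_smul_right, hx, smul_zero]) (fun t => hbasis r t s hs)
      (by simp [D]) v
  refine schur hpos fun u v s hs => ?_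
  obtain ⟨v, rfl⟩ := tau_surjective hδ hδ2 v
  exact sub_eq_zero.1 (hD u v s hs)

end Irreducible

/-! ### Real and quaternionic structures on representations -/

section Structures

variable {G : Type*} {V : Type} [Group G] [AddCommGroup V] [Module ℂ V]
  (π : Representation ℂ G V) (T : V →ₛₗ[starRingEnd ℂ] V)

/-- The real subspace fixed by a conjugate-linear map. -/
def fixedSubspace : Submodule ℝ V where
  carrier := {v | T v = v}
  add_mem' {v w} hv hw := by
    rw [Set.mem_ofPred_eq] at *
    rw [map_add, hv, hw]
  zero_mem' := map_zero T
  smul_mem' c v hv := by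
    rw [Set.mem_ofPred_eq] at *
    rw [← Complex.coe_smul, map_smulₛₗ, hv, Complex.conj_ofReal]

theorem mem_fixedSubspace {v : V} : v ∈ fixedSubspace T ↔ T v = v := Iff.rfl

theorem exists_eq_one_tmul_add {V₀ : Type*} [AddCommGroup V₀] [Module ℝ V₀] (t : ℂ ⊗[ℝ] V₀) :
    ∃ x y : V₀, t = 1 ⊗ₜ x + Complex.I ⊗ₜ y := by
  induction t with
  | zero => exact ⟨0, 0, by simp⟩
  | tmul c v =>
    refine ⟨c.re • v, c.im • v, ?_⟩
    rw [← TensorProduct.smul_tmul, ← TensorProduct.smul_tmul, ← TensorProduct.add_tmul]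
    congr 1
    conv_lhs => rw [← Complex.re_add_im c]
    simp
  | add s t hs ht =>
    obtain ⟨x, y, rfl⟩ := hs
    obtain ⟨x', y', rfl⟩ := ht
    refine ⟨x + x', y + y', ?_⟩
    rw [TensorProduct.tmul_add, TensorProduct.tmul_add]
    abel

theorem definedOverReal_of_realStructure (hT : ∀ v, T (T v) = v)
    (hπ : ∀ g v, T (π g v) = π g (T v)) : DefinedOverReal π := by
  let π₀ : Representation ℝ G (fixedSubspace T) :=
    { toFun := fun g => ((π g).restrictScalars ℝ).restrict fun v hv => by
        rw [mem_fixedSubspace] at *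
        exact (hπ g v).trans (congrArg _ hv)
      map_one' := by
        ext v
        simp [LinearMap.restrict_apply]
      map_mul' := fun g h => by
        ext v
        simp [LinearMap.restrict_apply] }
  let f : ℂ ⊗[ℝ] fixedSubspace T →ₗ[ℂ] V := (fixedSubspace T).subtype.liftBaseChange ℂ
  have hf : ∀ c (v : fixedSubspace T), f (c ⊗ₜ v) = c • (v : V) := fun c v => by
    simp [f]
  have hinj : Function.Injective f := by
    rw [injective_iff_map_eq_zero]
    intro t ht
    obtain ⟨x, y, rfl⟩ := exists_eq_one_tmul_add t
    rw [map_add, hf, hf, one_smul] at ht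
    have h2 := congrArg T ht
    rw [map_add, map_smulₛₗ, (mem_fixedSubspace T).1 x.2, (mem_fixedSubspace T).1 y.2, map_zero,
      Complex.conj_I] at h2
    have hx : (x : V) = 0 := by
      have : (2 : ℂ) • (x : V) = 0 := by
        calc (2 : ℂ) • (x : V) = (x + Complex.I • (y : V)) + (x + -Complex.I • (y : V)) := by
              module
          _ = 0 := by rw [ht, h2, add_zero]
      exact (smul_eq_zero.1 this).resolve_left two_ne_zero
    have hy : (y : V) = 0 := by
      rw [hx, zero_add] at ht
      exact (smul_eq_zero.1 ht).resolve_left Complex.I_ne_zero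
    rw [Subtype.ext (a1 := x) (a2 := 0) hx, Subtype.ext (a1 := y) (a2 := 0) hy]
    simp
  have hsurj : Function.Surjective f := fun v => by
    have hI := Complex.I_mul_I
    have h2 : starRingEnd ℂ (2 : ℂ) = 2 := Complex.conj_ofNat 2
    refine ⟨1 ⊗ₜ ⟨(1 / 2 : ℂ) • (v + T v), ?_⟩ +
      Complex.I ⊗ₜ ⟨(-Complex.I / 2 : ℂ) • (v - T v), ?_⟩, ?_⟩
    · rw [map_add, hf, hf, one_smul]
      change (1 / 2 : ℂ) • (v + T v) + Complex.I • (-Complex.I / 2) • (v - T v) = v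
      rw [smul_smul, show Complex.I * (-Complex.I / 2) = 1 / 2 by linear_combination -hI / 2]
      module
    · rw [mem_fixedSubspace, map_smulₛₗ, map_add, hT, add_comm, map_div₀, map_one, h2]
    · rw [mem_fixedSubspace, map_smulₛₗ, map_sub, hT, map_div₀, map_neg, Complex.conj_I, h2]
      module
  refine ⟨fixedSubspace T, inferInstance, inferInstance, π₀,
    LinearEquiv.ofBijective f ⟨hinj, hsurj⟩, fun g c v => ?_⟩
  change f _ = π g (f _)
  rw [hf, hf, map_smul]
  rfl

theorem not_definedOverReal_of_quaternionicStructure [Nontrivial V] (hT : ∀ v, T (T v) = -v)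
    (hπ : ∀ g v, T (π g v) = π g (T v))
    (hschur : ∀ A : Module.End ℂ V, (∀ g v, A (π g v) = π g (A v)) → ∃ c : ℂ, ∀ v, A v = c • v) :
    ¬ DefinedOverReal π := by
  rintro ⟨V₀, _, _, π₀, f, hf⟩
  let R : ℂ ⊗[ℝ] V₀ →ₗ[ℝ] ℂ ⊗[ℝ] V₀ := Complex.conjAe.toLinearMap.rTensor V₀
  have hR : ∀ c v, R (c ⊗ₜ v) = starRingEnd ℂ c ⊗ₜ v := fun c v => rfl
  have hRs : ∀ (c : ℂ) t, R (c • t) = starRingEnd ℂ c • R t := fun c t => by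
    induction t with
    | zero => simp
    | tmul d v => rw [TensorProduct.smul_tmul', hR, hR, TensorProduct.smul_tmul', smul_eq_mul,
        map_mul, smul_eq_mul]
    | add s t hs ht => rw [smul_add, map_add, hs, ht, map_add, smul_add]
  have hRR : ∀ t, R (R t) = t := fun t => by
    induction t with
    | zero => simp
    | tmul d v => rw [hR, hR, Complex.conj_conj]
    | add s t hs ht => rw [map_add, map_add, hs, ht]
  have hRπ : ∀ g t, f (R (f.symm (π g (f t)))) = π g (f (R t)) := fun g t => by
    induction t with
    | zero => simp
    | tmul d v => rw [← hf, LinearEquiv.symm_apply_apply, hR, hR, hf]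
    | add s t hs ht => simp only [map_add, hs, ht]
  let A : Module.End ℂ V :=
    { toFun := fun v => f (R (f.symm (T v)))
      map_add' := fun v w => by simp only [map_add]
      map_smul' := fun c v => by
        rw [map_smulₛₗ, map_smul, hRs, Complex.conj_conj, map_smul]; rfl }
  obtain ⟨c, hc⟩ := hschur A fun g v => by
    change f (R (f.symm (T (π g v)))) = π g (f (R (f.symm (T v))))
    rw [hπ, ← hRπ, LinearEquiv.apply_symm_apply]
  have hA : ∀ v, f (R (f.symm (T v))) = c • v := hc
  have h1 : ∀ v, T v = starRingEnd ℂ c • f (R (f.symm v)) := fun v => by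
    have h := congrArg (fun v => f (R (f.symm v))) (hA v)
    simpa only [LinearEquiv.symm_apply_apply, hRR, LinearEquiv.apply_symm_apply, map_smul, hRs]
      using h
  obtain ⟨v, hv⟩ := exists_ne (0 : V)
  have h2 := hT v
  rw [h1 (T v), hA, smul_smul, ← neg_one_smul ℂ v] at h2
  have h3 : starRingEnd ℂ c * c = -1 := smul_left_injective ℂ hv h2
  rw [← Complex.normSq_eq_conj_mul_self] at h3
  have h4 : Complex.normSq c = -1 := by exact_mod_cast h3
  linarith [Complex.normSq_nonneg c]

end Structures

section HalfSpinStructures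

variable {n : ℕ} {a : Fin n → ℂ}

/-- The restriction of the intertwiner to a half spin module. -/
def halfIntertwiner (ha : Unimodular a) (hn : Even n) (hpos : 0 < n) (p : ZMod 2) :
    S n p →ₛₗ[starRingEnd ℂ] S n p where
  toFun s := ⟨intertwiner a s, intertwiner_mem ha hn hpos s.2⟩
  map_add' _ _ := Subtype.ext (map_add (intertwiner a) _ _)
  map_smul' _ _ := Subtype.ext (map_smulₛₗ (intertwiner a) _ _)

theorem halfIntertwiner_comm (ha : Unimodular a) (hn : Even n) (hpos : 0 < n) {δ : ℝ}
    (hδ : ∀ i, a i ^ 2 = δ) (hδ2 : δ ^ 2 = 1)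
    {H : Subgroup (LinearMap.GeneralLinearGroup ℂ (W n))}
    (hH : ∀ x ∈ preimage H, ∀ w, rho n x (tau a w) = tau a (rho n x w)) (p : ZMod 2)
    (g : spinCover H) (s : S n p) :
    halfIntertwiner ha hn hpos p (res (halfSpin n p) (spinCover H) g s)
      = res (halfSpin n p) (spinCover H) g (halfIntertwiner ha hn hpos p s) := by
  apply Subtype.ext
  change intertwiner a (cliffordAction n (g : Spin n) s)
    = cliffordAction n (g : Spin n) (intertwiner a s)
  rw [intertwiner_cliffordAction ha hn, theta_eq_of_mem_spinCover ha hδ hδ2 hH g.2]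

theorem halfSpin_definedOverReal (ha : Unimodular a) (hn : Even n) (hpos : 0 < n) {δ : ℝ}
    (hδ : ∀ i, a i ^ 2 = δ) (hδ2 : δ ^ 2 = 1)
    {H : Subgroup (LinearMap.GeneralLinearGroup ℂ (W n))}
    (hH : ∀ x ∈ preimage H, ∀ w, rho n x (tau a w) = tau a (rho n x w)) {p : ZMod 2}
    (hT : ∀ s ∈ S n p, intertwiner a (intertwiner a s) = s) :
    DefinedOverReal (res (halfSpin n p) (spinCover H)) :=
  definedOverReal_of_realStructure _ (halfIntertwiner ha hn hpos p)
    (fun s => Subtype.ext (hT s s.2)) (halfIntertwiner_comm ha hn hpos hδ hδ2 hH p)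

theorem nontrivial_S (hpos : 0 < n) (p : ZMod 2) : Nontrivial (S n p) := by
  have hp : ∀ q : ZMod 2, q = 0 ∨ q = 1 := by decide
  have h1 : (1 : ExteriorAlgebra ℂ (W1 n)) ≠ 0 := one_ne_zero
  rcases hp p with rfl | rfl
  · exact ⟨⟨1, one_mem_S⟩, 0, fun h => h1 (congrArg Subtype.val h)⟩
  · obtain ⟨w, hw⟩ := exists_Q_eq_one hpos
    refine ⟨⟨vectorAction n w 1, vectorAction_mem (p := 0) w one_mem_S⟩, 0, fun h => h1 ?_⟩
    have h2 := vectorAction_vectorAction_self w (1 : ExteriorAlgebra ℂ (W1 n))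
    rw [hw, one_smul] at h2
    have h3 : vectorAction n w 1 = 0 := congrArg Subtype.val h
    rw [← h2, h3, map_zero]

theorem halfSpin_not_definedOverReal (ha : Unimodular a) (hn : Even n) (hpos : 0 < n) {δ : ℝ}
    (hδ : ∀ i, a i ^ 2 = δ) (hδ2 : δ ^ 2 = 1)
    {H : Subgroup (LinearMap.GeneralLinearGroup ℂ (W n))}
    (hH : ∀ x ∈ preimage H, ∀ w, rho n x (tau a w) = tau a (rho n x w))
    (hH' : ∀ h : Spin n, (∀ w, rho n h (tau a w) = tau a (rho n h w)) → h * h ∈ preimage H)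
    {p : ZMod 2} (hT : ∀ s ∈ S n p, intertwiner a (intertwiner a s) = -s) :
    ¬ DefinedOverReal (res (halfSpin n p) (spinCover H)) := by
  have := nontrivial_S hpos p
  refine not_definedOverReal_of_quaternionicStructure _ (halfIntertwiner ha hn hpos p)
    (fun s => Subtype.ext (hT s s.2)) (halfIntertwiner_comm ha hn hpos hδ hδ2 hH p) ?_
  intro A hA
  obtain ⟨B, hB⟩ := LinearMap.exists_extend ((S n p).subtype ∘ₗ A)
  have hB' : ∀ s : S n p, B s = A s := fun s => congrArg (fun f => f s) hB
  obtain ⟨c, hc⟩ := schur_spinCover ha hδ hδ2 hH' hpos (p := p) (A := B) fun g hg s hs => by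
    have h := congrArg Subtype.val (hA ⟨g, hg⟩ ⟨s, hs⟩)
    rw [← hB'] at h
    rw [hB' ⟨s, hs⟩]
    exact h
  exact ⟨c, fun s => Subtype.ext ((hB' s).symm.trans (hc s s.2))⟩

theorem rho_definedOverReal {δ : ℝ} (hδ : ∀ i, a i ^ 2 = δ) (hδ1 : δ = 1)
    {H : Subgroup (LinearMap.GeneralLinearGroup ℂ (W n))}
    (hH : ∀ x ∈ preimage H, ∀ w, rho n x (tau a w) = tau a (rho n x w)) :
    DefinedOverReal (res (rho n) (spinCover H)) := by
  refine definedOverReal_of_realStructure _ (tau a) (fun z => ?_) fun g w => ?_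
  · rw [tau_tau hδ, hδ1, Complex.ofReal_one, one_smul]
  · obtain ⟨x, hx, hxg⟩ := connectedComponentIn_subset _ _ g.2
    obtain rfl : x = g := Subtype.ext hxg
    exact (hH _ hx w).symm

end HalfSpinStructures

/-! ### The real groups in terms of the conjugate-linear isometries -/

section Groups

variable {n : ℕ}

theorem Q_rho (x : Spin n) (w : W n) : Q n (rho n x w) = Q n w := by
  apply (algebraMap ℂ (Cl n)).injective
  have hxs : star (x : Cl n) * x = 1 := spinGroup.coe_star_mul_self x
  have hsx : (x : Cl n) * star (x : Cl n) = 1 := spinGroup.coe_mul_star_self x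
  change algebraMap ℂ (Cl n) (Q n (rhoLin x w)) = _
  rw [← ι_sq_scalar, iota_rhoLin]
  calc _ = (x : Cl n) * ι (Q n) w * (star (x : Cl n) * x) * ι (Q n) w * star (x : Cl n) := by
        simp only [mul_assoc]
    _ = (x : Cl n) * (ι (Q n) w * ι (Q n) w) * star (x : Cl n) := by
        rw [hxs, mul_one, mul_assoc (x : Cl n)]
    _ = _ := by rw [ι_sq_scalar, ← Algebra.commutes, mul_assoc, hsx, mul_one]

theorem b_rho (x : Spin n) (z w : W n) : b n (rho n x z) (rho n x w) = b n z w := by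
  rw [← polar_Q, ← polar_Q, QuadraticMap.polar, QuadraticMap.polar, ← map_add, Q_rho, Q_rho,
    Q_rho]

theorem det_sq_eq_one {g : W n →ₗ[ℂ] W n} (hg : ∀ z w, b n (g z) (g w) = b n z w) :
    LinearMap.det g ^ 2 = 1 := by
  let B : LinearMap.BilinForm ℂ (W n) := QuadraticMap.polarBilin (Q n)
  have hB : ∀ z w, B z w = b n z w := polar_Q n
  have h1 : B.comp g g = B := by
    apply LinearMap.ext; intro z; apply LinearMap.ext; intro w
    rw [LinearMap.BilinForm.comp_apply, hB, hB, hg]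
  have hBB : B.toMatrix' * B.toMatrix' = 1 := by
    ext r s
    simp only [Matrix.mul_apply, LinearMap.BilinForm.toMatrix'_apply, hB]
    have hl : ∀ r s, b n (Pi.single r 1) (Pi.single s 1)
        = if s = Sum.swap r then 1 else 0 := by
      rintro (i | i) s
      · rw [show (Pi.single (Sum.inl i) 1 : W n) = e n (Sum.inl i) from rfl, b_e_inl]
        by_cases h : s = Sum.inr i
        · simp [h]
        · simp [h, Ne.symm h]
      · rw [show (Pi.single (Sum.inr i) 1 : W n) = e n (Sum.inr i) from rfl, b_e_inr]
        by_cases h : s = Sum.inl i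
        · simp [h]
        · simp [h, Ne.symm h]
    simp only [hl]
    rw [Finset.sum_eq_single (Sum.swap r) (fun t _ ht => by simp [ht]) (by simp)]
    rcases eq_or_ne s r with rfl | h
    · simp
    · simp [h, Ne.symm h]
  have hdet : B.toMatrix'.det ≠ 0 := by
    have h := congrArg Matrix.det hBB
    rw [Matrix.det_mul, Matrix.det_one] at h
    exact left_ne_zero_of_mul_eq_one h
  have h2 := congrArg (fun C : LinearMap.BilinForm ℂ (W n) => C.toMatrix'.det) h1
  simp only [LinearMap.BilinForm.toMatrix'_comp, Matrix.det_mul, Matrix.det_transpose,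
    LinearMap.det_toMatrix'] at h2
  refine mul_right_cancel₀ hdet ?_
  rw [one_mul]
  linear_combination h2

theorem eq_of_forall_b_eq {x y : W n} (h : ∀ z, b n z x = b n z y) : x = y := by
  ext (i | i)
  · rw [← b_e_inr i x, ← b_e_inr i y, h]
  · rw [← b_e_inl i x, ← b_e_inl i y, h]

theorem unimodular_I : Unimodular (fun _ : Fin n => Complex.I) := fun _ => by simp

theorem b_tau_I (z w : W n) : b n z (tau (fun _ => Complex.I) w) = Complex.I * psi0 n z w := by
  rw [b, psi0, ← Finset.sum_sub_distrib, Finset.mul_sum]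
  refine Finset.sum_congr rfl fun i _ => ?_
  rw [tau_inl, tau_inr, Complex.conj_I]
  ring

theorem rho_tau_of_mem_SOstar {x : Spin n} (hx : x ∈ preimage (SOstar n)) (w : W n) :
    rho n x (tau (fun _ => Complex.I) w) = tau (fun _ => Complex.I) (rho n x w) := by
  obtain ⟨-, -, hpsi⟩ := hx
  have hpsi' : ∀ z w, psi0 n (rho n x z) (rho n x w) = psi0 n z w := hpsi
  refine eq_of_forall_b_eq fun z => ?_
  have hz : rho n x (rho n x⁻¹ z) = z := by
    rw [← Module.End.mul_apply, ← map_mul, mul_inv_cancel, map_one, Module.End.one_apply]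
  rw [← hz, b_rho, b_tau_I, b_tau_I, hpsi']

theorem mul_self_mem_preimage_SOstar {h : Spin n} (hh : ∀ w,
    rho n h (tau (fun _ => Complex.I) w) = tau (fun _ => Complex.I) (rho n h w)) :
    h * h ∈ preimage (SOstar n) := by
  have hpsi : ∀ z w, psi0 n (rho n h z) (rho n h w) = psi0 n z w := fun z w => by
    have h1 := b_rho h z (tau (fun _ => Complex.I) w)
    rw [hh, b_tau_I, b_tau_I] at h1
    exact mul_left_cancel₀ Complex.I_ne_zero h1
  refine ⟨?_, fun z w => b_rho (h * h) z w, fun z w => ?_⟩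
  · change LinearMap.det (rho n (h * h)) = 1
    rw [map_mul, map_mul, ← sq]
    exact det_sq_eq_one (b_rho h)
  · change psi0 n (rho n (h * h) z) (rho n (h * h) w) = psi0 n z w
    rw [map_mul, Module.End.mul_apply, Module.End.mul_apply, hpsi, hpsi]

/-- The signs in the conjugate-linear map that fixes the basis `realBasis n k`. -/
def signs (n k : ℕ) (i : Fin n) : ℂ := if i.val < k then -1 else 1

theorem signs_sq (k : ℕ) (i : Fin n) : signs n k i ^ 2 = ((1 : ℝ) : ℂ) := by
  rw [signs]; split_ifs <;> simp

theorem unimodular_signs (k : ℕ) : Unimodular (signs n k) := fun i => by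
  rw [signs]; split_ifs <;> simp

theorem tau_realBasis (k : ℕ) (r : Fin n ⊕ Fin n) :
    tau (signs n k) (realBasis n k r) = realBasis n k r := by
  ext (j | j) <;> rcases r with i | i <;> by_cases hij : j = i
  all_goals first
    | (subst hij
       by_cases hk : j.val < k <;> simp [tau_inl, tau_inr, signs, realBasis, e, hk])
    | (by_cases hk : i.val < k <;> simp [tau_inl, tau_inr, realBasis, e, hk, hij])

theorem eta_apply_self_sq (k : ℕ) (r : Fin n ⊕ Fin n) : eta n k r r * eta n k r r = 1 := by
  rcases r with i | i <;> by_cases hk : i.val < k <;> simp [eta, hk]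

theorem eta_apply_ne (k : ℕ) {r s : Fin n ⊕ Fin n} (h : r ≠ s) : eta n k r s = 0 := by
  simp [eta, h]

theorem b_add_right (x y z : W n) : b n x (y + z) = b n x y + b n x z := by
  simp only [b, ← Finset.sum_add_distrib, Pi.add_apply]
  exact Finset.sum_congr rfl fun i _ => by ring

theorem b_smul_right (c : ℂ) (x y : W n) : b n x (c • y) = c * b n x y := by
  simp only [b, Finset.mul_sum, Pi.smul_apply, smul_eq_mul]
  exact Finset.sum_congr rfl fun i _ => by ring

theorem b_sum_smul {κ : Type*} (t : Finset κ) (c : κ → ℂ) (x : W n) (y : κ → W n) :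
    b n x (∑ r ∈ t, c r • y r) = ∑ r ∈ t, c r * b n x (y r) := by
  classical
  induction t using Finset.induction_on with
  | empty => simp [b]
  | insert r t hr ih => rw [Finset.sum_insert hr, b_add_right, ih, b_smul_right,
      Finset.sum_insert hr]

theorem eq_sum_realBasis (k : ℕ) (z : W n) :
    z = ∑ r, (b n (realBasis n k r) z * (eta n k r r : ℂ) / 2) • realBasis n k r := by
  refine realBasis_induction k (P := fun z => z = ∑ r,
    (b n (realBasis n k r) z * (eta n k r r : ℂ) / 2) • realBasis n k r)
    (fun x y hx hy => ?_) (fun c x hx => ?_) (fun s => ?_) ?_ z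
  · conv_lhs => rw [hx, hy]
    simp only [b_add_right, add_mul, add_div, add_smul, Finset.sum_add_distrib]
  · conv_lhs => rw [hx]
    simp only [b_smul_right, Finset.smul_sum, smul_smul, mul_assoc, mul_div_assoc]
  · rw [Finset.sum_eq_single s]
    · rw [b_realBasis]
      have h : ((2 * eta n k s s : ℝ) : ℂ) * (eta n k s s : ℂ) / 2 = 1 := by
        have h1 := congrArg (fun x : ℝ => (x : ℂ)) (eta_apply_self_sq k s)
        push_cast at h1 ⊢
        linear_combination h1
      rw [h, one_smul]
    · intro r _ hr
      rw [b_realBasis, eta_apply_ne k hr]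
      simp
    · simp
  · simp [b]

theorem exists_real_coordinates (k : ℕ) {z : W n} (hz : tau (signs n k) z = z) :
    ∃ c : Fin n ⊕ Fin n → ℝ, z = ∑ r, (c r : ℂ) • realBasis n k r := by
  refine ⟨fun r => (b n (realBasis n k r) z).re * eta n k r r / 2, ?_⟩
  conv_lhs => rw [eq_sum_realBasis k z]
  refine Finset.sum_congr rfl fun r _ => ?_
  have h : ((b n (realBasis n k r) z).re : ℂ) = b n (realBasis n k r) z := by
    apply Complex.conj_eq_iff_re.1
    rw [← b_tau (unimodular_signs k), tau_realBasis, hz]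
  push_cast
  rw [h]

theorem rho_tau_of_mem_SOpqOnW {k : ℕ} {x : Spin n} (hx : x ∈ preimage (SOpqOnW n k)) (w : W n) :
    rho n x (tau (signs n k) w) = tau (signs n k) (rho n x w) := by
  obtain ⟨A, -, hA⟩ := hx
  have hA' : ∀ s, rho n x (realBasis n k s)
      = ∑ r, (((A : Matrix _ _ ℝ) r s : ℝ) : ℂ) • realBasis n k r := hA
  refine realBasis_induction k (P := fun w => rho n x (tau (signs n k) w)
    = tau (signs n k) (rho n x w)) (fun x y hx hy => ?_) (fun c x hx => ?_) (fun s => ?_) ?_ w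
  · simp only [map_add, hx, hy]
  · simp only [map_smulₛₗ, hx, RingHom.id_apply]
  · rw [tau_realBasis, hA', map_sum]
    refine Finset.sum_congr rfl fun r _ => ?_
    rw [map_smulₛₗ, tau_realBasis, Complex.conj_ofReal]
  · simp

theorem mul_self_mem_preimage_SOpqOnW {k : ℕ} {h : Spin n} (hh : ∀ w,
    rho n h (tau (signs n k) w) = tau (signs n k) (rho n h w)) :
    h * h ∈ preimage (SOpqOnW n k) := by
  have hreal : ∀ s, ∃ c : Fin n ⊕ Fin n → ℝ,
      rho n h (realBasis n k s) = ∑ r, (c r : ℂ) • realBasis n k r := fun s =>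
    exists_real_coordinates k (by rw [← hh, tau_realBasis])
  choose c hc using hreal
  let A : Matrix (Fin n ⊕ Fin n) (Fin n ⊕ Fin n) ℝ := Matrix.of fun r s => c s r
  have hAeta : A.transpose * eta n k * A = eta n k := by
    ext s t
    have h1 := b_rho h (realBasis n k s) (realBasis n k t)
    rw [hc t, b_sum_smul, b_realBasis] at h1
    simp only [b_comm (rho n h (realBasis n k s))] at h1
    simp only [hc s, b_sum_smul, b_realBasis] at h1
    rw [Matrix.mul_apply]
    simp only [Matrix.mul_apply, Matrix.transpose_apply, A, Matrix.of_apply]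
    have h2 : ∑ r, c t r * ∑ r', c s r' * (2 * eta n k r r') = 2 * eta n k s t := by
      exact_mod_cast h1
    have hsymm : ∀ r r', eta n k r r' = eta n k r' r := fun r r' => by
      rcases eq_or_ne r r' with rfl | hr
      · rfl
      · rw [eta_apply_ne k hr, eta_apply_ne k hr.symm]
    have h3 : ∑ r, (∑ r', c s r' * eta n k r' r) * c t r
        = (∑ r, c t r * ∑ r', c s r' * (2 * eta n k r r')) / 2 := by
      rw [Finset.sum_div]
      refine Finset.sum_congr rfl fun r _ => ?_
      rw [Finset.sum_mul, Finset.mul_sum, Finset.sum_div]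
      refine Finset.sum_congr rfl fun r' _ => ?_
      rw [hsymm r r']
      ring
    rw [h3, h2]
    ring
  have heta : eta n k * eta n k = 1 := by
    rw [eta, Matrix.diagonal_mul_diagonal, ← Matrix.diagonal_one]
    congr 1
    ext (i | i) <;> by_cases hk : i.val < k <;> simp [hk]
  have hdet : (A * A).det = 1 := by
    have h0 : (eta n k).det ≠ 0 := by
      have h := congrArg Matrix.det heta
      rw [Matrix.det_mul, Matrix.det_one] at h
      exact left_ne_zero_of_mul_eq_one h
    have h := congrArg Matrix.det hAeta
    rw [Matrix.det_mul, Matrix.det_mul, Matrix.det_transpose] at h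
    rw [Matrix.det_mul]
    refine mul_right_cancel₀ h0 ?_
    linear_combination h
  refine ⟨⟨A * A, hdet⟩, ?_, fun s => ?_⟩
  · change (A * A).transpose * eta n k * (A * A) = eta n k
    rw [Matrix.transpose_mul]
    calc _ = A.transpose * (A.transpose * eta n k * A) * A := by simp only [Matrix.mul_assoc]
      _ = _ := by rw [hAeta, hAeta]
  · change rho n (h * h) (realBasis n k s) = ∑ r, (((A * A) r s : ℝ) : ℂ) • realBasis n k r
    rw [map_mul, Module.End.mul_apply, hc, map_sum]
    simp only [map_smul, hc, Finset.smul_sum, smul_smul]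
    rw [Finset.sum_comm]
    refine Finset.sum_congr rfl fun r _ => ?_
    rw [← Finset.sum_smul, Matrix.mul_apply]
    push_cast
    congr 1
    exact Finset.sum_congr rfl fun t _ => mul_comm _ _

theorem prod_signs {k : ℕ} (hk : k ≤ n) : ∏ i, signs n k i = (-1) ^ k := by
  simp only [signs]
  rw [Finset.prod_ite, Finset.prod_const, Finset.prod_const_one, mul_one,
    Fin.card_filter_val_lt, min_eq_right hk]

theorem neg_one_pow_choose_two (m : ℕ) : (-1 : ℂ) ^ ((2 * m).choose 2) = (-1) ^ m := by
  rcases m with _ | m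
  · simp
  · have h : (2 * (m + 1)).choose 2 = (2 * m + 1) * (m + 1) := by
      rw [Nat.choose_two_right]
      refine Nat.div_eq_of_eq_mul_left two_pos ?_
      rw [show 2 * (m + 1) - 1 = 2 * m + 1 by omega]
      ring
    rw [h, pow_mul, Odd.neg_one_pow ⟨m, rfl⟩]

end Groups

end HalfSpin
end

theorem mainTheorem6 (m : ℕ) (hm : 1 ≤ m) :
    (HalfSpin.DefinedOverReal
        (HalfSpin.res (HalfSpin.Splus (2 * m)) (HalfSpin.spinCover (HalfSpin.SOstar (2 * m)))) ∧
      ¬ HalfSpin.DefinedOverReal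
        (HalfSpin.res (HalfSpin.Sminus (2 * m)) (HalfSpin.spinCover (HalfSpin.SOstar (2 * m))))) ∧
    ∀ k : ℕ, k ≤ 2 * m →
      ((k ≡ m [MOD 2] →
        HalfSpin.DefinedOverReal (HalfSpin.res (HalfSpin.Splus (2 * m))
          (HalfSpin.spinCover (HalfSpin.SOpqOnW (2 * m) k))) ∧
        HalfSpin.DefinedOverReal (HalfSpin.res (HalfSpin.Sminus (2 * m))
          (HalfSpin.spinCover (HalfSpin.SOpqOnW (2 * m) k))) ∧
        HalfSpin.DefinedOverReal (HalfSpin.res (HalfSpin.rho (2 * m))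
          (HalfSpin.spinCover (HalfSpin.SOpqOnW (2 * m) k)))) ∧
      (¬ k ≡ m [MOD 2] →
        ¬ HalfSpin.DefinedOverReal (HalfSpin.res (HalfSpin.Splus (2 * m))
          (HalfSpin.spinCover (HalfSpin.SOpqOnW (2 * m) k))) ∧
        ¬ HalfSpin.DefinedOverReal (HalfSpin.res (HalfSpin.Sminus (2 * m))
          (HalfSpin.spinCover (HalfSpin.SOpqOnW (2 * m) k))))) := by
  have hn : Even (2 * m) := even_two_mul m
  have hpos : 0 < 2 * m := by omega
  constructor
  · have hδ : ∀ i : Fin (2 * m), (fun _ => Complex.I) i ^ 2 = ((-1 : ℝ) : ℂ) := fun i => by simp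
    have hδ2 : (-1 : ℝ) ^ 2 = 1 := by norm_num
    have hc : (-1 : ℂ) ^ ((2 * m).choose 2) * ∏ _i : Fin (2 * m), Complex.I = 1 := by
      rw [HalfSpin.neg_one_pow_choose_two, Finset.prod_const, Finset.card_univ, Fintype.card_fin,
        pow_mul, Complex.I_sq, ← mul_pow]
      simp
    constructor
    · refine HalfSpin.halfSpin_definedOverReal HalfSpin.unimodular_I hn hpos hδ hδ2
        (fun x hx => HalfSpin.rho_tau_of_mem_SOstar hx) fun s hs => ?_
      rw [HalfSpin.intertwiner_intertwiner HalfSpin.unimodular_I hn hδ hδ2 hs, hc, one_smul]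
    · refine HalfSpin.halfSpin_not_definedOverReal HalfSpin.unimodular_I hn hpos hδ hδ2
        (fun x hx => HalfSpin.rho_tau_of_mem_SOstar hx)
        (fun h hh => HalfSpin.mul_self_mem_preimage_SOstar hh) fun s hs => ?_
      rw [HalfSpin.intertwiner_intertwiner_odd HalfSpin.unimodular_I hn hpos hδ hδ2 hs, hc]
      simp
  · intro k hk
    have ha := HalfSpin.unimodular_signs (n := 2 * m) k
    have hδ := HalfSpin.signs_sq (n := 2 * m) k
    have hδ2 : (1 : ℝ) ^ 2 = 1 := one_pow 2
    have hH : ∀ x ∈ HalfSpin.preimage (HalfSpin.SOpqOnW (2 * m) k), ∀ w,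
        HalfSpin.rho _ x (HalfSpin.tau (HalfSpin.signs (2 * m) k) w)
          = HalfSpin.tau (HalfSpin.signs (2 * m) k) (HalfSpin.rho _ x w) :=
      fun x hx => HalfSpin.rho_tau_of_mem_SOpqOnW hx
    have hT : ∀ p : ZMod 2, ∀ s ∈ HalfSpin.S (2 * m) p,
        HalfSpin.intertwiner (HalfSpin.signs (2 * m) k)
          (HalfSpin.intertwiner (HalfSpin.signs (2 * m) k) s) = ((-1) ^ (m + k) : ℂ) • s := by
      have hp : ∀ q : ZMod 2, q = 0 ∨ q = 1 := by decide
      intro p s hs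
      rcases hp p with rfl | rfl
      · rw [HalfSpin.intertwiner_intertwiner ha hn hδ hδ2 hs, HalfSpin.prod_signs hk,
          HalfSpin.neg_one_pow_choose_two, pow_add]
      · rw [HalfSpin.intertwiner_intertwiner_odd ha hn hpos hδ hδ2 hs, HalfSpin.prod_signs hk,
          HalfSpin.neg_one_pow_choose_two, pow_add, Complex.ofReal_one, one_mul]
    constructor
    · intro hkm
      have heven : Even (m + k) := by
        rw [Nat.even_iff]; unfold Nat.ModEq at hkm; omega
      have hT' : ∀ p : ZMod 2, ∀ s ∈ HalfSpin.S (2 * m) p,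
          HalfSpin.intertwiner (HalfSpin.signs (2 * m) k)
            (HalfSpin.intertwiner (HalfSpin.signs (2 * m) k) s) = s := fun p s hs => by
        rw [hT p s hs, heven.neg_one_pow, one_smul]
      exact ⟨HalfSpin.halfSpin_definedOverReal ha hn hpos hδ hδ2 hH (hT' 0),
        HalfSpin.halfSpin_definedOverReal ha hn hpos hδ hδ2 hH (hT' 1),
        HalfSpin.rho_definedOverReal hδ rfl hH⟩
    · intro hkm
      have hodd : Odd (m + k) := by
        rw [Nat.odd_iff]; unfold Nat.ModEq at hkm; omega
      have hT' : ∀ p : ZMod 2, ∀ s ∈ HalfSpin.S (2 * m) p,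
          HalfSpin.intertwiner (HalfSpin.signs (2 * m) k)
            (HalfSpin.intertwiner (HalfSpin.signs (2 * m) k) s) = -s := fun p s hs => by
        rw [hT p s hs, hodd.neg_one_pow, neg_one_smul]
      have hH' : ∀ h : HalfSpin.Spin (2 * m),
          (∀ w, HalfSpin.rho _ h (HalfSpin.tau (HalfSpin.signs (2 * m) k) w)
            = HalfSpin.tau (HalfSpin.signs (2 * m) k) (HalfSpin.rho _ h w)) →
          h * h ∈ HalfSpin.preimage (HalfSpin.SOpqOnW (2 * m) k) :=
        fun h hh => HalfSpin.mul_self_mem_preimage_SOpqOnW hh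
      exact ⟨HalfSpin.halfSpin_not_definedOverReal ha hn hpos hδ hδ2 hH hH' (hT' 0),
        HalfSpin.halfSpin_not_definedOverReal ha hn hpos hδ hδ2 hH hH' (hT' 1)⟩
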